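/- Let $K$ be a field of characteristic zero, $V$ a $K$-vector space, $f:V\to V$ a linear endomorphism, and $T(V)$ the tensor algebra with empty word $\emptyset$, concatenation product, and shuffle product ш (with $\emptyset$ ш $u=u=u$ ш $\emptyset$ and $xu$ ш $yv=x(u$ ш $yv)+y(xu$ ш $v)$ for $x,y\in V$). Let $\bullet$ be the bilinear product on $T(V)$ defined by $\emptyset\bullet w'=0$ and $xw\bullet w'=x(w\bullet w')+f(x)(w$ ш $w')$ for $x\in V$, $w,w'\in T(V)$. It is a right pre-Lie product; $T(V)$ with this product, and with the Lie bracket $[a,b]=a\bullet b-b\bullet a$, is denoted by $T(V,f)$. Let $S=S(T(V,f))$ be the symmetric algebra, with product $\times$, unit $1$, and the coproduct $\Delta(z)=z^{(1)}\otimes z^{(2)}$ for which $\times$ is compatible and the elements of $T(V,f)$ are primitive; $T(V,f)$ is identified with its image in $S$. There is exactly one bilinear extension $\bullet:S\otimes S\to S$ of the pre-Lie product such that, for $X,Y,Z\in S$ and $u,v\in T(V,f)$: $X\bullet 1=X$; $u\bullet(X\times v)=(u\bullet X)\bullet v-u\bullet(X\bullet v)$; $(X\times Y)\bullet Z=(X\bullet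 Z^{(1)})\times(Y\bullet Z^{(2)})$. It satisfies $T(V,f)\bullet S\subseteq T(V,f)$. The product $X\star Y=(X\bullet Y^{(1)})\times Y^{(2)}$ is associative with unit $1$, and there is an isomorphism of algebras from the enveloping algebra of the Lie algebra $T(V,f)$ to $(S,\star)$ that is the identity on $T(V,f)$. Let $w_1,\dots,w_k\in T(V,f)$, $k\ge 0$. For $I=\{i_1<\dots<i_p\}\subseteq\{1,\dots,k\}$ put $w_I=w_{i_1}\times\dots\times w_{i_p}$ and $w_I^{ш}=w_{i_1}$ ш $\cdots$ ш $w_{i_p}$ (with $w_\emptyset=1$ and $w_\emptyset^{ш}=\emptyset$), and let $\overline I$ be the complement of $I$. Below, $\sqcup$ denotes a disjoint union of possibly empty sets, and the sums run over all ordered families of such sets. For all $x\in V$ and $w\in T(V,f)$: 1. If $k\ge1$, then $\emptyset\bullet(w_1\times\dots\times w_k)=0$. 2. $xw\bullet(w_1\times\dots\times w_k)=\sum_{I\subseteq\{1,\dots,k\}}f^{k-|I|}(x)\big((w\bullet w_I)$ ш $w_{\overline I}^{ш}\big)$. 3. $\emptyset\star(w_1\times\dots\times w_k)=\emptyset\times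 w_1\times\dots\times w_k$. 4. $xw\star(w_1\times\dots\times w_k)=\sum_{I\sqcup J\sqcup L=\{1,\dots,k\}}\Big(f^{|J|}(x)\big((w\bullet w_I)$ ш $w_J^{ш}\big)\Big)\times w_L$. For $i\ge1$, $x_1,\dots,x_i\in V$ and pairwise disjoint sets $I_1,\dots,I_i\subseteq\{1,\dots,k\}$, put $N_{i+1}=\emptyset$, $N_j=f^{|I_j|}(x_j)\big(N_{j+1}$ ш $w_{I_j}^{ш}\big)$ for $j=i,\dots,1$, and $N(I_1,\dots,I_i)=N_1$, that is, $$N(I_1,\dots,I_i)=f^{|I_1|}(x_1)\Big(f^{|I_2|}(x_2)\big(\cdots\big(f^{|I_i|}(x_i)\,w_{I_i}^{ш}\big)\,ш\,w_{I_{i-1}}^{ш}\cdots\big)\,ш\,w_{I_1}^{ш}\Big).$$ Then: 5. $x_1\cdots x_i\bullet(w_1\times\dots\times w_k)=\sum_{I_1\sqcup\dots\sqcup I_i=\{1,\dots,k\}}N(I_1,\dots,I_i)$. 6. $x_1\cdots x_i\star(w_1\times\dots\times w_k)=\sum_{I_1\sqcup\dots\sqcup I_{i+1}=\{1,\dots,k\}}N(I_1,\dots,I_i)\times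 w_{I_{i+1}}$. -/

import Mathlib

open scoped TensorProduct

noncomputable section

namespace ComPreLie

universe u v w

variable {K : Type u} [CommRing K] {V : Type v} [AddCommGroup V] [Module K V]

/-! ### Linear maps out of `T(V)` defined by recursion on the length of words -/

section Recursion

variable {M : Type w} [AddCommGroup M] [Module K M]

/-- One step of the recursion `F (x u) = φ x u (F u)`, on pairs `(u, F u)`. -/
def wordRecStep (φ : V →ₗ[K] TensorAlgebra K V × M →ₗ[K] M) :
    V →ₗ[K] Module.End K (TensorAlgebra K V × M) where
  toFun x := LinearMap.prod
    (LinearMap.mulLeft K (TensorAlgebra.ι K x) ∘ₗ LinearMap.fst K _ _) (φ x)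
  map_add' x y := by ext <;> simp [add_mul]
  map_smul' c x := by ext <;> simp

/-- The linear map `F : T(V) → M` with `F ∅ = m₀` and `F (x u) = φ x (u, F u)`
for `x ∈ V`, `u ∈ T(V)`. -/
def wordRec (m₀ : M) (φ : V →ₗ[K] TensorAlgebra K V × M →ₗ[K] M) :
    TensorAlgebra K V →ₗ[K] M :=
  LinearMap.snd K (TensorAlgebra K V) M ∘ₗ
    LinearMap.applyₗ ((1 : TensorAlgebra K V), m₀) ∘ₗ
      (TensorAlgebra.lift K (wordRecStep φ)).toLinearMap

/-- To prove a linear property of all of `T(V)` it is enough to treat words, letter by letter. -/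
theorem word_induction {P : TensorAlgebra K V → Prop} (u : TensorAlgebra K V)
    (one : P 1) (cons : ∀ (x : V) (u : TensorAlgebra K V), P u → P (TensorAlgebra.ι K x * u))
    (add : ∀ a b, P a → P b → P (a + b)) (smul : ∀ (c : K) (a), P a → P (c • a)) : P u := by
  suffices h : ∀ b, P b → P (u * b) by simpa using h 1 one
  induction u using TensorAlgebra.induction with
  | algebraMap r => intro b hb; rw [← Algebra.smul_def]; exact smul r b hb
  | ι x => intro b hb; exact cons x b hb
  | mul a b iha ihb => intro c hc; rw [mul_assoc]; exact iha _ (ihb _ hc)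
  | add a b iha ihb => intro c hc; rw [add_mul]; exact add _ _ (iha _ hc) (ihb _ hc)

theorem wordRec_one (m₀ : M) (φ : V →ₗ[K] TensorAlgebra K V × M →ₗ[K] M) :
    wordRec m₀ φ 1 = m₀ := by
  simp [wordRec]

theorem wordRec_cons (m₀ : M) (φ : V →ₗ[K] TensorAlgebra K V × M →ₗ[K] M) (x : V)
    (u : TensorAlgebra K V) :
    wordRec m₀ φ (TensorAlgebra.ι K x * u) = φ x (u, wordRec m₀ φ u) := by
  have key : ∀ u : TensorAlgebra K V,
      (TensorAlgebra.lift K (wordRecStep φ) u ((1 : TensorAlgebra K V), m₀)).1 = u := by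
    intro u
    induction u using word_induction with
    | one => simp
    | cons x u ih =>
      rw [map_mul, TensorAlgebra.lift_ι_apply, Module.End.mul_apply]
      exact congrArg (TensorAlgebra.ι K x * ·) ih
    | add a b ha hb => simp [ha, hb]
    | smul c a ha => simp [ha]
  have h2 : TensorAlgebra.lift K (wordRecStep φ) u ((1 : TensorAlgebra K V), m₀)
      = (u, wordRec m₀ φ u) := Prod.ext (key u) rfl
  simp only [wordRec, LinearMap.comp_apply, AlgHom.toLinearMap_apply, map_mul,
    TensorAlgebra.lift_ι_apply, LinearMap.applyₗ_apply_apply, Module.End.mul_apply,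
    LinearMap.snd_apply]
  rw [h2]
  rfl

end Recursion

/-! ### The shuffle product and the pre-Lie product -/

/-- Deconcatenation `T(V) → T(V) ⊗ T(V)`, sending `x₁…xₙ` to the sum of the
`x₁…xᵢ ⊗ xᵢ₊₁…xₙ`, `0 ≤ i ≤ n`. -/
def deconc : TensorAlgebra K V →ₗ[K] TensorAlgebra K V ⊗[K] TensorAlgebra K V :=
  wordRec (1 ⊗ₜ[K] 1)
    { toFun := fun x => LinearMap.coprod
        (TensorProduct.mk K _ _ 1 ∘ₗ LinearMap.mulLeft K (TensorAlgebra.ι K x))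
        (LinearMap.rTensor _ (LinearMap.mulLeft K (TensorAlgebra.ι K x)))
      map_add' := fun x y => by
        ext <;> simp [add_mul, TensorProduct.tmul_add, TensorProduct.add_tmul]
      map_smul' := fun c x => by ext <;> simp [TensorProduct.smul_tmul'] }

theorem deconc_one : deconc (1 : TensorAlgebra K V) = 1 ⊗ₜ[K] 1 := wordRec_one _ _

theorem deconc_cons (x : V) (u : TensorAlgebra K V) :
    deconc (TensorAlgebra.ι K x * u) = 1 ⊗ₜ[K] (TensorAlgebra.ι K x * u) +
      LinearMap.rTensor _ (LinearMap.mulLeft K (TensorAlgebra.ι K x)) (deconc u) := by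
  rw [deconc, wordRec_cons]; rfl

/-- For an endomorphism `L` of `T(V)`, the map
`y₁…yₙ ↦ ∑_{0 ≤ i ≤ n} y₁…yᵢ x L(yᵢ₊₁…yₙ)`. -/
def insertLetter (x : V) (L : Module.End K (TensorAlgebra K V)) :
    Module.End K (TensorAlgebra K V) :=
  LinearMap.mul' K _ ∘ₗ
    LinearMap.lTensor _ (LinearMap.mulLeft K (TensorAlgebra.ι K x) ∘ₗ L) ∘ₗ deconc

theorem insertLetter_one (x : V) (L : Module.End K (TensorAlgebra K V)) :
    insertLetter x L 1 = TensorAlgebra.ι K x * L 1 := by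
  simp [insertLetter, deconc_one]

theorem insertLetter_cons (x : V) (L : Module.End K (TensorAlgebra K V)) (y : V)
    (v : TensorAlgebra K V) :
    insertLetter x L (TensorAlgebra.ι K y * v) =
      TensorAlgebra.ι K x * L (TensorAlgebra.ι K y * v) +
        TensorAlgebra.ι K y * insertLetter x L v := by
  simp only [insertLetter, LinearMap.comp_apply, deconc_cons, map_add, LinearMap.lTensor_tmul,
    LinearMap.mul'_apply, one_mul, LinearMap.mulLeft_apply]
  congr 1
  induction deconc v using TensorProduct.induction_on with
  | zero => simp
  | tmul a b => simp [mul_assoc]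
  | add a b ha hb => simp only [map_add, ha, hb, mul_add]

/-- The shuffle product of `T(V)`; it is characterised by `one_shuffle`, `shuffle_one` and
`cons_shuffle_cons` below. -/
def shuffle : TensorAlgebra K V →ₗ[K] TensorAlgebra K V →ₗ[K] TensorAlgebra K V :=
  wordRec (M := Module.End K (TensorAlgebra K V)) LinearMap.id
    { toFun := fun x =>
        { toFun := fun p => insertLetter x p.2
          map_add' := fun p q => by
            simp [insertLetter, LinearMap.comp_add, LinearMap.lTensor_add, LinearMap.add_comp]
          map_smul' := fun c p => by
            simp [insertLetter, LinearMap.comp_smul, LinearMap.lTensor_smul,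
              LinearMap.smul_comp] }
      map_add' := fun x y => by
        apply LinearMap.ext; intro p
        have h : LinearMap.mulLeft K (TensorAlgebra.ι K x + TensorAlgebra.ι K y)
          = LinearMap.mulLeft K (TensorAlgebra.ι K x) +
            LinearMap.mulLeft K (TensorAlgebra.ι K y) := by
          apply LinearMap.ext; intro; simp [add_mul]
        simp [insertLetter, h, LinearMap.comp_add, LinearMap.lTensor_add, LinearMap.add_comp]
      map_smul' := fun c x => by
        apply LinearMap.ext; intro p
        have h : LinearMap.mulLeft K (c • TensorAlgebra.ι K x)
          = c • LinearMap.mulLeft K (TensorAlgebra.ι K x) := by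
          apply LinearMap.ext; intro; simp
        simp [insertLetter, h, LinearMap.comp_smul, LinearMap.lTensor_smul,
          LinearMap.smul_comp] }

theorem one_shuffle (v : TensorAlgebra K V) : shuffle 1 v = v := by
  rw [shuffle, wordRec_one]; rfl

theorem cons_shuffle (x : V) (u : TensorAlgebra K V) :
    shuffle (TensorAlgebra.ι K x * u) = insertLetter x (shuffle u) := by
  conv_lhs => rw [shuffle, wordRec_cons]
  rfl

theorem cons_shuffle_cons (x y : V) (u v : TensorAlgebra K V) :
    shuffle (TensorAlgebra.ι K x * u) (TensorAlgebra.ι K y * v) =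
      TensorAlgebra.ι K x * shuffle u (TensorAlgebra.ι K y * v) +
        TensorAlgebra.ι K y * shuffle (TensorAlgebra.ι K x * u) v := by
  simp only [cons_shuffle, insertLetter_cons]

theorem shuffle_one (u : TensorAlgebra K V) : shuffle u 1 = u := by
  induction u using word_induction with
  | one => exact one_shuffle 1
  | cons x u ih => rw [cons_shuffle, insertLetter_one, ih]
  | add a b ha hb => simp [ha, hb]
  | smul c a ha => simp [ha]

theorem shuffle_comm (a b : TensorAlgebra K V) : shuffle a b = shuffle b a := by
  induction a using word_induction generalizing b with
  | one => rw [one_shuffle, shuffle_one]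
  | cons x u ihu =>
    induction b using word_induction with
    | one => rw [one_shuffle, shuffle_one]
    | cons y v ihv =>
      rw [cons_shuffle_cons, cons_shuffle_cons, ihu, ihv, add_comm]
    | add a b ha hb => simp [ha, hb]
    | smul c a ha => simp [ha]
  | add a b ha hb => simp [ha, hb]
  | smul c a ha => simp [ha]

theorem shuffle_assoc (a b c : TensorAlgebra K V) :
    shuffle (shuffle a b) c = shuffle a (shuffle b c) := by
  induction a using word_induction generalizing b c with
  | one => simp only [one_shuffle]
  | cons x u ihu =>
    induction b using word_induction generalizing c with
    | one => simp only [one_shuffle, shuffle_one]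
    | cons y v ihv =>
      induction c using word_induction with
      | one => simp only [shuffle_one]
      | cons z t iht =>
        have h1 := ihu (TensorAlgebra.ι K y * v) (TensorAlgebra.ι K z * t)
        have h2 := ihv (TensorAlgebra.ι K z * t)
        rw [cons_shuffle_cons y z, map_add] at h1
        rw [cons_shuffle_cons x y, map_add, LinearMap.add_apply] at iht
        rw [cons_shuffle_cons x y u v, cons_shuffle_cons y z v t, map_add, LinearMap.add_apply,
          map_add, cons_shuffle_cons x z (shuffle u _) t, cons_shuffle_cons y z _ t,
          cons_shuffle_cons x y u (shuffle v _), cons_shuffle_cons x z u (shuffle _ t),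
          h2, ← iht, h1]
        simp only [mul_add]
        abel
      | add a b ha hb => simp [ha, hb]
      | smul c a ha => simp [ha]
    | add a b ha hb => simp [ha, hb]
    | smul c a ha => simp [ha]
  | add a b ha hb => simp [ha, hb]
  | smul c a ha => simp [ha]

/-- The bilinear product `•` of `T(V)` attached to the endomorphism `f`; it is characterised by
`one_bullet` and `cons_bullet` below. -/
def bullet (f : V →ₗ[K] V) :
    TensorAlgebra K V →ₗ[K] TensorAlgebra K V →ₗ[K] TensorAlgebra K V :=
  wordRec (M := Module.End K (TensorAlgebra K V)) 0
    { toFun := fun x => LinearMap.coprod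
        (LinearMap.compRight K (LinearMap.mulLeft K (TensorAlgebra.ι K (f x))) ∘ₗ shuffle)
        (LinearMap.compRight K (LinearMap.mulLeft K (TensorAlgebra.ι K x)))
      map_add' := fun x y => by
        apply LinearMap.ext; intro p; apply LinearMap.ext; intro t
        simp [add_mul]; abel
      map_smul' := fun c x => by
        apply LinearMap.ext; intro p; apply LinearMap.ext; intro t
        simp }

theorem one_bullet (f : V →ₗ[K] V) (v : TensorAlgebra K V) : bullet f 1 v = 0 := by
  rw [bullet, wordRec_one]; rfl

theorem cons_bullet (f : V →ₗ[K] V) (x : V) (u v : TensorAlgebra K V) :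
    bullet f (TensorAlgebra.ι K x * u) v =
      TensorAlgebra.ι K x * bullet f u v + TensorAlgebra.ι K (f x) * shuffle u v := by
  rw [add_comm]
  conv_lhs => rw [bullet, wordRec_cons]
  rfl

theorem shuffle_bullet (f : V →ₗ[K] V) (a b c : TensorAlgebra K V) :
    bullet f (shuffle a b) c = shuffle (bullet f a c) b + shuffle a (bullet f b c) := by
  induction a using word_induction generalizing b with
  | one => simp [one_shuffle, one_bullet]
  | cons x u ihu =>
    induction b using word_induction with
    | one => simp [shuffle_one, one_bullet]
    | cons y v ihv =>
      rw [cons_shuffle_cons]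
      simp only [map_add, LinearMap.add_apply, cons_bullet, ihu, ihv, cons_shuffle_cons, mul_add]
      have h1 : shuffle (shuffle u c) (TensorAlgebra.ι K y * v)
          = shuffle (shuffle u (TensorAlgebra.ι K y * v)) c := by
        rw [shuffle_assoc, shuffle_comm c, shuffle_assoc]
      have h2 := shuffle_assoc (TensorAlgebra.ι K x * u) v c
      rw [h1, h2]
      abel
    | add a b ha hb => simp only [map_add, LinearMap.add_apply, ha, hb]; abel
    | smul c a ha => simp [ha]
  | add a b ha hb => simp only [map_add, LinearMap.add_apply, ha, hb]; abel
  | smul c a ha => simp [ha]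

theorem bullet_preLie (f : V →ₗ[K] V) (a b c : TensorAlgebra K V) :
    bullet f (bullet f a b) c - bullet f a (bullet f b c) =
      bullet f (bullet f a c) b - bullet f a (bullet f c b) := by
  induction a using word_induction with
  | one => simp [one_bullet]
  | cons x u ih =>
    simp only [cons_bullet, map_add, LinearMap.add_apply, shuffle_bullet, mul_add]
    have h := congrArg (TensorAlgebra.ι K x * ·) ih
    simp only [mul_sub] at h
    rw [shuffle_assoc, shuffle_assoc, shuffle_comm b c, shuffle_comm (bullet f u b) c,
      shuffle_comm (bullet f u c) b, shuffle_comm c (bullet f u b),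
      shuffle_comm b (bullet f u c)]
    rw [← sub_eq_zero] at h ⊢
    rw [← h]
    abel
  | add a b ha hb =>
    simp only [map_add, LinearMap.add_apply, add_sub_add_comm, ha, hb]
  | smul c a ha => simp only [map_smul, LinearMap.smul_apply, ← smul_sub, ha]

/-! ### The pre-Lie algebra `T(V, f)` -/

/-- The vector space `T(V)`, to be equipped with the pre-Lie product `•` attached to `f`. -/
def TVf (_f : V →ₗ[K] V) : Type (max u v) := TensorAlgebra K V

instance (f : V →ₗ[K] V) : AddCommGroup (TVf f) :=
  inferInstanceAs (AddCommGroup (TensorAlgebra K V))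

instance (f : V →ₗ[K] V) : Module K (TVf f) :=
  inferInstanceAs (Module K (TensorAlgebra K V))

/-- The identity map from `T(V)` to `T(V, f)`. -/
def toTVf (f : V →ₗ[K] V) : TensorAlgebra K V ≃ₗ[K] TVf f := LinearEquiv.refl K _

/-- The multiplication of `T(V, f)` is `•`. -/
instance (f : V →ₗ[K] V) : NonUnitalNonAssocRing (TVf f) where
  mul a b := toTVf f (bullet f ((toTVf f).symm a) ((toTVf f).symm b))
  left_distrib a b c := by
    change toTVf f _ = toTVf f _ + toTVf f _
    simp
  right_distrib a b c := by
    change toTVf f _ = toTVf f _ + toTVf f _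
    simp
  zero_mul a := by change toTVf f _ = 0; simp
  mul_zero a := by change toTVf f _ = 0; simp

theorem TVf_mul_def (f : V →ₗ[K] V) (a b : TVf f) :
    a * b = toTVf f (bullet f ((toTVf f).symm a) ((toTVf f).symm b)) := rfl

instance (f : V →ₗ[K] V) : RightPreLieRing (TVf f) where
  assoc_symm' a b c := by
    simp only [associator_apply, TVf_mul_def, LinearEquiv.symm_apply_apply, ← map_sub]
    rw [bullet_preLie]

instance (f : V →ₗ[K] V) : RightPreLieAlgebra K (TVf f) where
  smul_assoc c a b := by simp [TVf_mul_def]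
  smul_comm c a b := by simp [TVf_mul_def]

/-! ### The extension of `•` to `S(T(V, f))` and the product `⋆` -/

/-- The symmetric algebra `S(T(V, f))`; its product is written `×` in the literature. -/
abbrev STVf (f : V →ₗ[K] V) : Type (max u v) := SymmetricAlgebra K (TVf f)

/-- The inclusion `T(V) = T(V, f) → S(T(V, f))`. -/
def incl (f : V →ₗ[K] V) : TensorAlgebra K V →ₗ[K] STVf f :=
  SymmetricAlgebra.ι K (TVf f) ∘ₗ (toTVf f).toLinearMap

/-- `B` is an extension of the pre-Lie product of `T(V, f)` to a product on `S(T(V, f))` in the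
sense of Oudom and Guin. The coproduct is that of Mathlib's bialgebra `SymmetricAlgebra`, for
which the elements of `T(V, f)` are primitive. -/
structure IsOudomGuinExtension (f : V →ₗ[K] V) (B : STVf f →ₗ[K] STVf f →ₗ[K] STVf f) :
    Prop where
  /-- `B` extends `•`. -/
  extends_bullet : ∀ u v : TensorAlgebra K V, B (incl f u) (incl f v) = incl f (bullet f u v)
  /-- `X • 1 = X`. -/
  apply_one : ∀ X : STVf f, B X 1 = X
  /-- `u • (X × v) = (u • X) • v - u • (X • v)` for `u, v ∈ T(V, f)`. -/
  incl_mul : ∀ (u v : TensorAlgebra K V) (X : STVf f),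
    B (incl f u) (X * incl f v) =
      B (B (incl f u) X) (incl f v) - B (incl f u) (B X (incl f v))
  /-- `(X × Y) • Z = (X • Z⁽¹⁾) × (Y • Z⁽²⁾)`. -/
  mul_apply : ∀ X Y Z : STVf f,
    B (X * Y) Z = LinearMap.mul' K (STVf f)
      (TensorProduct.map (B X) (B Y) (Coalgebra.comul (R := K) Z))

/-- The product `X ⋆ Y = (X • Y⁽¹⁾) × Y⁽²⁾`, where `• = B`. -/
def star {f : V →ₗ[K] V} (B : STVf f →ₗ[K] STVf f →ₗ[K] STVf f) (X Y : STVf f) : STVf f :=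
  LinearMap.mul' K (STVf f)
    (TensorProduct.map (B X) LinearMap.id (Coalgebra.comul (R := K) Y))

/-! ### Notation for the formulas -/

/-- `w_I = w_{i₁} × … × w_{i_p}` for `I = {i₁ < … < i_p}`. -/
def timesProd (f : V →ₗ[K] V) {k : ℕ} (w : Fin k → TensorAlgebra K V) (I : Finset (Fin k)) :
    STVf f :=
  ∏ i ∈ I, incl f (w i)

/-- The iterated shuffle `w_{i₁} ⧢ … ⧢ w_{i_p}` for `I = {i₁ < … < i_p}`
(the empty word if `I` is empty). -/
def shuffleProd {k : ℕ} (w : Fin k → TensorAlgebra K V) (I : Finset (Fin k)) :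
    TensorAlgebra K V :=
  (((List.finRange k).filter (· ∈ I)).map w).foldr (fun a b => shuffle a b) 1

/-- The families `(I₁, …, I_n)` of pairwise disjoint, possibly empty, sets with union
`{1, …, k}`. -/
def orderedPartitions (n k : ℕ) : Finset (Fin n → Finset (Fin k)) :=
  Finset.univ.filter fun P =>
    (∀ a b, a ≠ b → Disjoint (P a) (P b)) ∧ Finset.univ.biUnion P = Finset.univ

/-- The nested element
`f^|I₁|(x₁) (f^|I₂|(x₂) (… (f^|I_i|(x_i) w_{I_i}^⧢) ⧢ w_{I_{i-1}}^⧢ …) ⧢ w_{I₁}^⧢)`, built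
from the inside, starting from the empty word. -/
def nested (f : V →ₗ[K] V) {k : ℕ} (w : Fin k → TensorAlgebra K V) :
    (i : ℕ) → (Fin i → V) → (Fin i → Finset (Fin k)) → TensorAlgebra K V
  | 0, _, _ => 1
  | i + 1, x, P =>
      TensorAlgebra.ι K ((f ^ (P 0).card) (x 0)) *
        shuffle (nested f w i (fun j => x j.succ) (fun j => P j.succ)) (shuffleProd w (P 0))

end ComPreLie

end

open scoped TensorProduct

noncomputable section

namespace ComPreLie

/-! ### Derivations of the symmetric algebra. -/

section SymmetricDerivation

variable {R M : Type*} [CommRing R] [AddCommGroup M] [Module R M]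

/-! Write L = T(V, f). Two families of operators on S(L) govern everything: X ↦ X • v, the
derivation extending right multiplication by v, and X ↦ X ⋆ v = X • v + X × v. By the right pre-Lie
identity the second family is a right action of the Lie algebra L, so u₁⋯uₙ ↦ u₁ ⋆ ⋯ ⋆ uₙ is well
defined from U(L) to S(L). It is bijective (`envEquivSym`), by an argument without filtrations: the
operation • v is rebuilt on U(L), the operators p ↦ p v - p • v turn out to commute, hence S(L) acts
on U(L), and the orbit map of 1 is the inverse. In particular the operators X ↦ X ⋆ v generate S(L)
from 1 (`starRight_induction`).

The axiom for u • (X × v) says exactly that u • (X ⋆ v) = (u • X) • v. Together with u • 1 = u it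
determines u • X, and multiplicativity in the left argument then gives uniqueness. For existence, u
• X is defined by recursion on the word u, through the coproduct form of formula 2 (`extBullet`), so
that it lies in T(V) by construction. The identity above is then a theorem (`extBullet_starRight`);
it rests on the fact that • v is a derivation of the shuffle product (`shuffle_bullet`). The action
extends to a product on S(L) as an algebra morphism into the convolution algebra. Since ⋆ v is a
coderivation and • v a derivation, X • (Y ⋆ v) = (X • Y) • v holds for every X
(`oudomGuin_starRight`), and similarly X ⋆ (Y ⋆ v) = (X ⋆ Y) ⋆ v. The latter makes U(L) → S(L)
multiplicative, and ⋆ inherits associativity.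

The formulas follow because the coproduct of w₁ × ⋯ × w_k is a sum over subsets of {1, …, k}:
formula 2 unfolds the recursion, and the others iterate it, one member of the partition at a time.
-/

theorem symDerivation_ext {N : Type*} [AddCommGroup N] [Module R N]
    [Module (SymmetricAlgebra R M) N]
    {D₁ D₂ : Derivation R (SymmetricAlgebra R M) N}
    (h : ∀ m, D₁ (SymmetricAlgebra.ι R M m) = D₂ (SymmetricAlgebra.ι R M m)) : D₁ = D₂ := by
  ext a
  induction a using SymmetricAlgebra.induction with
  | algebraMap r => simp
  | ι x => exact h x
  | mul a b ha hb => simp [ha, hb]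
  | add a b ha hb => simp [ha, hb]

/-- Every submodule of `S(M)` which contains `1` and is stable under multiplication by the
elements of `M` is the whole of `S(M)`. -/
theorem sym_induction {P : SymmetricAlgebra R M → Prop} (one : P 1)
    (mul_ι : ∀ X v, P X → P (X * SymmetricAlgebra.ι R M v))
    (add : ∀ X Y, P X → P Y → P (X + Y)) (smul : ∀ (c : R) X, P X → P (c • X))
    (X : SymmetricAlgebra R M) : P X := by
  suffices h : ∀ Y, P Y → P (Y * X) by simpa using h 1 one
  induction X using SymmetricAlgebra.induction with
  | algebraMap r =>
    intro Y hY; rw [mul_comm, ← Algebra.smul_def]; exact smul r Y hY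
  | ι x => intro Y hY; exact mul_ι Y x hY
  | mul a b iha ihb => intro Y hY; rw [← mul_assoc]; exact ihb _ (iha _ hY)
  | add a b iha ihb => intro Y hY; rw [mul_add]; exact add _ _ (iha _ hY) (ihb _ hY)

/-- The algebra morphism `X ↦ X + ε D(X)`, where `D` is the derivation extending `φ`. -/
def symDerivationAux (φ : M →ₗ[R] M) :
    SymmetricAlgebra R M →ₐ[R]
      TrivSqZeroExt (SymmetricAlgebra R M) (SymmetricAlgebra R M) :=
  SymmetricAlgebra.lift
    ((TrivSqZeroExt.inlAlgHom R _ _).toLinearMap ∘ₗ SymmetricAlgebra.ι R M +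
      (TrivSqZeroExt.inrHom _ _).restrictScalars R ∘ₗ SymmetricAlgebra.ι R M ∘ₗ φ)

/-- Once the first component is known to be the identity, the product of dual numbers turns
multiplicativity into the Leibniz rule for the second component. -/
theorem fst_symDerivationAux (φ : M →ₗ[R] M) (a : SymmetricAlgebra R M) :
    (symDerivationAux φ a).fst = a := by
  induction a using SymmetricAlgebra.induction with
  | algebraMap r => rw [AlgHom.commutes]; rfl
  | ι x => simp [symDerivationAux]
  | mul a b ha hb => simp [ha, hb]
  | add a b ha hb => simp [ha, hb]

/-- The derivation of the symmetric algebra extending an endomorphism of the module. -/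
def symDerivation (φ : M →ₗ[R] M) :
    Derivation R (SymmetricAlgebra R M) (SymmetricAlgebra R M) :=
  Derivation.mk'
    ((TrivSqZeroExt.sndHom (SymmetricAlgebra R M) (SymmetricAlgebra R M)).restrictScalars R ∘ₗ
      (symDerivationAux φ).toLinearMap)
    (fun a b => by simp [fst_symDerivationAux, mul_comm])

@[simp]
theorem symDerivation_ι (φ : M →ₗ[R] M) (m : M) :
    symDerivation φ (SymmetricAlgebra.ι R M m) = SymmetricAlgebra.ι R M (φ m) := by
  simp [symDerivation, symDerivationAux]

/-- The square-zero extension R ⊕ M is a commutative algebra containing M, so the morphism S(M) → R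
⊕ M recovers each element of M from its image. -/
theorem symι_injective : Function.Injective (SymmetricAlgebra.ι R M) := by
  -- The algebra structure on R ⊕ M asks for a right action on M, here the left action again.
  let _ : Module Rᵐᵒᵖ M := Module.compHom _ ((RingHom.id R).fromOpposite mul_comm)
  have _ : IsCentralScalar R M := ⟨fun r m => rfl⟩
  let F : SymmetricAlgebra R M →ₐ[R] TrivSqZeroExt R M :=
    SymmetricAlgebra.lift (TrivSqZeroExt.inrHom R M)
  intro x y h
  have h' := congrArg (fun a => (F a).snd) h
  simpa [F] using h'

end SymmetricDerivation

attribute [local instance] LieRing.ofAssociativeRing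

/-! ### Right actions of the enveloping algebra. -/

section Enveloping

variable {K L : Type*} [CommRing K]

section Lie

variable [LieRing L] [LieAlgebra K L]

theorem enveloping_induction {P : UniversalEnvelopingAlgebra K L → Prop}
    (one : P 1) (mul_ι : ∀ p u, P p → P (p * UniversalEnvelopingAlgebra.ι K u))
    (add : ∀ a b, P a → P b → P (a + b)) (smul : ∀ (c : K) (a), P a → P (c • a))
    (p : UniversalEnvelopingAlgebra K L) : P p := by
  obtain ⟨a, rfl⟩ : ∃ a, UniversalEnvelopingAlgebra.mkAlgHom K L a = p :=
    Quotient.mk_surjective p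
  suffices h : ∀ b, P b → P (b * UniversalEnvelopingAlgebra.mkAlgHom K L a) by
    simpa using h 1 one
  induction a using TensorAlgebra.induction with
  | algebraMap r =>
    intro b hb
    rw [AlgHom.commutes, ← Algebra.commutes, ← Algebra.smul_def]
    exact smul r b hb
  | ι x => intro b hb; exact mul_ι b x hb
  | mul a b iha ihb => intro c hc; rw [map_mul, ← mul_assoc]; exact ihb _ (iha _ hc)
  | add a b iha ihb => intro c hc; rw [map_add, mul_add]; exact add _ _ (iha _ hc) (ihb _ hc)

variable {M : Type*} [AddCommGroup M] [Module K M]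

/-- The right action of the enveloping algebra given by a right action of the Lie algebra. -/
def rightActionHom (r : L →ₗ[K] Module.End K M)
    (hr : ∀ u v m, r ⁅u, v⁆ m = r v (r u m) - r u (r v m)) :
    UniversalEnvelopingAlgebra K L →ₐ[K] (Module.End K M)ᵐᵒᵖ :=
  UniversalEnvelopingAlgebra.lift K
    { (MulOpposite.opLinearEquiv K).toLinearMap ∘ₗ r with
      map_lie' := fun {u v} => by
        apply MulOpposite.unop_injective
        ext m
        simp [hr, LieRing.of_associative_ring_bracket] }

/-- The orbit map `p ↦ m · p` of a right action of the Lie algebra. -/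
def orbitMap (r : L →ₗ[K] Module.End K M)
    (hr : ∀ u v m, r ⁅u, v⁆ m = r v (r u m) - r u (r v m)) (m : M) :
    UniversalEnvelopingAlgebra K L →ₗ[K] M :=
  LinearMap.applyₗ m ∘ₗ (MulOpposite.opLinearEquiv K).symm.toLinearMap ∘ₗ
    (rightActionHom r hr).toLinearMap

variable (r : L →ₗ[K] Module.End K M) (hr : ∀ u v m, r ⁅u, v⁆ m = r v (r u m) - r u (r v m))

theorem orbitMap_one (m : M) : orbitMap r hr m 1 = m := by simp [orbitMap]

theorem orbitMap_mul_ι (m : M) (p : UniversalEnvelopingAlgebra K L) (u : L) :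
    orbitMap r hr m (p * UniversalEnvelopingAlgebra.ι K u) = r u (orbitMap r hr m p) := by
  have h : rightActionHom r hr (UniversalEnvelopingAlgebra.ι K u) = MulOpposite.op (r u) :=
    UniversalEnvelopingAlgebra.lift_ι_apply K _ u
  simp only [orbitMap, LinearMap.comp_apply, AlgHom.toLinearMap_apply, map_mul, h]
  simp

end Lie

/-! ### The isomorphism U(L) ≃ S(L) for a right pre-Lie algebra L. -/

section PreLie

variable [RightPreLieRing L] [RightPreLieAlgebra K L]

theorem mul_mul_sub_mul_mul (x y z : L) :
    x * y * z - x * (y * z) = x * z * y - x * (z * y) :=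
  RightPreLieRing.assoc_symm x y z

variable (K L) in
/-- The derivation of `S(L)` extending the right multiplication by `v`. -/
def bulletDer : L →ₗ[K] Derivation K (SymmetricAlgebra K L) (SymmetricAlgebra K L) where
  toFun v := symDerivation (LinearMap.mulRight K v)
  map_add' v w := symDerivation_ext fun x => by simp [mul_add]
  map_smul' c v := symDerivation_ext fun x => by simp [mul_smul_comm c x v]

@[simp]
theorem bulletDer_ι (u v : L) :
    bulletDer K L v (SymmetricAlgebra.ι K L u) = SymmetricAlgebra.ι K L (u * v) := by
  simp [bulletDer]

/-- A commutator of derivations is a derivation, so it suffices to compare on L, where the identity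
is the right pre-Lie identity. -/
theorem bulletDer_lie (u v : L) (X : SymmetricAlgebra K L) :
    bulletDer K L ⁅u, v⁆ X =
      bulletDer K L v (bulletDer K L u X) - bulletDer K L u (bulletDer K L v X) := by
  have h : bulletDer K L ⁅u, v⁆ = ⁅bulletDer K L v, bulletDer K L u⁆ := by
    apply symDerivation_ext
    intro x
    rw [Derivation.commutator_apply]
    simp only [bulletDer_ι, ← map_sub, Ring.lie_def, mul_sub]
    congr 1
    linear_combination (norm := abel) -mul_mul_sub_mul_mul x u v
  rw [h, Derivation.commutator_apply]

variable (K L) in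
/-- The operator `X ↦ X • v + X × v`, which is the right product `X ↦ X ⋆ v`. -/
def starRight : L →ₗ[K] Module.End K (SymmetricAlgebra K L) where
  toFun v := (bulletDer K L v : SymmetricAlgebra K L →ₗ[K] SymmetricAlgebra K L) +
    LinearMap.mulRight K (SymmetricAlgebra.ι K L v)
  map_add' v w := by ext X; simp [mul_add]; abel
  map_smul' c v := by ext X; simp

theorem starRight_apply (v : L) (X : SymmetricAlgebra K L) :
    starRight K L v X = bulletDer K L v X + X * SymmetricAlgebra.ι K L v := rfl

/-- The cross terms (X • u) × v + (X • v) × u and X × u × v are symmetric in u and v and cancel;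
what remains is `bulletDer_lie` and X × (u • v - v • u). -/
theorem starRight_lie (u v : L) (X : SymmetricAlgebra K L) :
    starRight K L ⁅u, v⁆ X =
      starRight K L v (starRight K L u X) - starRight K L u (starRight K L v X) := by
  have h : SymmetricAlgebra.ι K L ⁅u, v⁆ =
      SymmetricAlgebra.ι K L (u * v) - SymmetricAlgebra.ι K L (v * u) := by
    rw [Ring.lie_def, map_sub]
  simp only [starRight_apply, map_add, Derivation.leibniz, bulletDer_ι, bulletDer_lie,
    h, smul_eq_mul]
  ring

variable (K L) in
/-- The comparison map `U(L) → S(L)`, which sends `u₁ ⋯ uₙ` to `u₁ ⋆ ⋯ ⋆ uₙ`. -/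
def envToSym : UniversalEnvelopingAlgebra K L →ₗ[K] SymmetricAlgebra K L :=
  orbitMap (starRight K L) starRight_lie 1

theorem envToSym_one : envToSym K L 1 = 1 := orbitMap_one _ _ _

theorem envToSym_mul_ι (p : UniversalEnvelopingAlgebra K L) (u : L) :
    envToSym K L (p * UniversalEnvelopingAlgebra.ι K u) = starRight K L u (envToSym K L p) :=
  orbitMap_mul_ι _ _ _ _ _

theorem envToSym_ι (u : L) :
    envToSym K L (UniversalEnvelopingAlgebra.ι K u) = SymmetricAlgebra.ι K L u := by
  rw [← one_mul (UniversalEnvelopingAlgebra.ι K u), envToSym_mul_ι, envToSym_one,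
    starRight_apply]
  simp

variable (K L) in
/-- The right action of `u` on pairs `(p, d)`, where `d v` plays the role of `p • v`. -/
def envBulletStep : L →ₗ[K] Module.End K
    (UniversalEnvelopingAlgebra K L × (L →ₗ[K] UniversalEnvelopingAlgebra K L)) :=
  LinearMap.mk₂ K
    (fun u p => (p.1 * UniversalEnvelopingAlgebra.ι K u,
      LinearMap.mulRight K (UniversalEnvelopingAlgebra.ι K u) ∘ₗ p.2 +
      LinearMap.mulLeft K p.1 ∘ₗ (UniversalEnvelopingAlgebra.ι K : L →ₗ⁅K⁆ _).toLinearMap ∘ₗ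
        LinearMap.mulLeft K u - p.2 ∘ₗ LinearMap.mulRight K u))
    (fun u u' p => by
      ext
      · simp [mul_add]
      · simp [mul_add, add_mul]; abel)
    (fun c u p => by
      ext v
      · simp
      · simp [smul_add, smul_sub, smul_mul_assoc c u v, mul_smul_comm c v u])
    (fun u p q => by
      ext
      · simp [add_mul]
      · simp [add_mul]; abel)
    (fun c u p => by
      ext
      · simp
      · simp [smul_add, smul_sub])

theorem envBulletStep_fst (u : L)
    (p : UniversalEnvelopingAlgebra K L × (L →ₗ[K] UniversalEnvelopingAlgebra K L)) :
    (envBulletStep K L u p).1 = p.1 * UniversalEnvelopingAlgebra.ι K u := rfl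

theorem envBulletStep_snd (u v : L)
    (p : UniversalEnvelopingAlgebra K L × (L →ₗ[K] UniversalEnvelopingAlgebra K L)) :
    (envBulletStep K L u p).2 v = p.2 v * UniversalEnvelopingAlgebra.ι K u +
      p.1 * UniversalEnvelopingAlgebra.ι K (u * v) - p.2 (v * u) := rfl

theorem env_ι_lie (u v : L) :
    UniversalEnvelopingAlgebra.ι K (u * v) - UniversalEnvelopingAlgebra.ι K (v * u) =
      UniversalEnvelopingAlgebra.ι K u * UniversalEnvelopingAlgebra.ι K v -
        UniversalEnvelopingAlgebra.ι K v * UniversalEnvelopingAlgebra.ι K u := by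
  rw [← map_sub, ← Ring.lie_def, LieHom.map_lie, LieRing.of_associative_ring_bracket]

/-- This compatibility lets the recursion for p • v, stated on products of elements of L, descend to
U(L). -/
theorem envBulletStep_lie (u u' : L)
    (p : UniversalEnvelopingAlgebra K L × (L →ₗ[K] UniversalEnvelopingAlgebra K L)) :
    envBulletStep K L ⁅u, u'⁆ p = envBulletStep K L u' (envBulletStep K L u p) -
      envBulletStep K L u (envBulletStep K L u' p) := by
  have hι := env_ι_lie (K := K) u u'
  refine Prod.ext ?_ (LinearMap.ext fun v => ?_)
  · simp only [envBulletStep_fst, Prod.fst_sub, mul_assoc, ← mul_sub, ← hι]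
    rw [Ring.lie_def, map_sub]
  · simp only [envBulletStep_snd, envBulletStep_fst, Prod.snd_sub, LinearMap.sub_apply]
    have h₁ := env_ι_lie (K := K) (u * v) u'
    have h₂ := env_ι_lie (K := K) u (u' * v)
    have h₃ : p.2 (v * ⁅u, u'⁆) = p.2 (v * u * u') - p.2 (v * u' * u) := by
      rw [← map_sub, Ring.lie_def, mul_sub]
      congr 1
      linear_combination (norm := abel) -mul_mul_sub_mul_mul v u u'
    -- The pre-Lie identity gives [u, u'] • v = [u • v, u'] + [u, u' • v] - (u • (v • u') - u' • (v
    -- • u)). The two brackets become commutators in U(L); the last terms occur as such in the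
    -- iterated steps.
    have h₄ : UniversalEnvelopingAlgebra.ι K (⁅u, u'⁆ * v) =
        UniversalEnvelopingAlgebra.ι K (u * v * u') - UniversalEnvelopingAlgebra.ι K (u' * (u * v))
        + (UniversalEnvelopingAlgebra.ι K (u * (u' * v)) -
          UniversalEnvelopingAlgebra.ι K (u' * v * u)) -
        (UniversalEnvelopingAlgebra.ι K (u * (v * u')) -
          UniversalEnvelopingAlgebra.ι K (u' * (v * u))) := by
      simp only [← map_sub, ← map_add, Ring.lie_def, sub_mul]
      congr 1
      have h := mul_mul_sub_mul_mul u u' v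
      have h' := mul_mul_sub_mul_mul u' u v
      linear_combination (norm := abel) h - h'
    rw [h₃, h₄, h₁, h₂]
    simp only [Ring.lie_def, map_sub, mul_sub, add_mul, sub_mul, mul_add, mul_assoc] at hι ⊢
    have h₅ := congrArg (p.2 v * ·) hι
    simp only [mul_sub] at h₅
    rw [h₅]
    abel

variable (K L) in
/-- The operation on `U(L)` which corresponds to `X ↦ X • v` on `S(L)`. -/
def envBullet : UniversalEnvelopingAlgebra K L →ₗ[K] L →ₗ[K] UniversalEnvelopingAlgebra K L :=
  LinearMap.snd K _ _ ∘ₗ orbitMap (envBulletStep K L) envBulletStep_lie (1, 0)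

theorem envBullet_one (v : L) : envBullet K L 1 v = 0 := by
  simp [envBullet, orbitMap_one]

/-- The shape comes from S(L): there (P ⋆ u) • v = (P • v) ⋆ u + P ⋆ (u • v) - P • (v • u), by the
Leibniz rule and `bulletDer_lie`. -/
theorem envBullet_mul_ι (p : UniversalEnvelopingAlgebra K L) (u v : L) :
    envBullet K L (p * UniversalEnvelopingAlgebra.ι K u) v =
      envBullet K L p v * UniversalEnvelopingAlgebra.ι K u +
        p * UniversalEnvelopingAlgebra.ι K (u * v) - envBullet K L p (v * u) := by
  -- The first component of the pair only carries p along, for use in the second.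
  have h : ∀ p, (orbitMap (envBulletStep K L) envBulletStep_lie (1, 0) p).1 = p := by
    intro p
    induction p using enveloping_induction with
    | one => rw [orbitMap_one]
    | mul_ι p u hp => rw [orbitMap_mul_ι, envBulletStep_fst, hp]
    | add a b ha hb => simp [ha, hb]
    | smul c a ha => simp [ha]
  simp only [envBullet, LinearMap.comp_apply, orbitMap_mul_ι, LinearMap.snd_apply,
    envBulletStep_snd, h]

/-- The right pre-Lie identity with first argument in U(L). The induction needs v and w free, since
it calls the hypothesis at (v • u, w) and (v, w • u) as well. -/
theorem envBullet_envBullet (p : UniversalEnvelopingAlgebra K L) (v w : L) :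
    envBullet K L (envBullet K L p w) v - envBullet K L (envBullet K L p v) w =
      envBullet K L p (w * v) - envBullet K L p (v * w) := by
  induction p using enveloping_induction generalizing v w with
  | one => simp [envBullet_one]
  | mul_ι p u hp =>
    simp only [envBullet_mul_ι, map_sub, map_add, LinearMap.add_apply, LinearMap.sub_apply]
    have h₁ := congrArg (· * UniversalEnvelopingAlgebra.ι K u) (hp v w)
    have h₂ := hp (v * u) w
    have h₃ := hp v (w * u)
    have h₄ : UniversalEnvelopingAlgebra.ι K (u * w * v) - UniversalEnvelopingAlgebra.ι K (u * v * w)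
        = UniversalEnvelopingAlgebra.ι K (u * (w * v)) -
          UniversalEnvelopingAlgebra.ι K (u * (v * w)) := by
      rw [← map_sub, ← map_sub]
      congr 1
      rw [sub_eq_sub_iff_sub_eq_sub, mul_mul_sub_mul_mul]
    replace h₄ := congrArg (p * ·) h₄
    have h₅ := congrArg (envBullet K L p) (mul_mul_sub_mul_mul w u v)
    have h₆ := congrArg (envBullet K L p) (mul_mul_sub_mul_mul v u w)
    simp only [sub_mul, mul_sub, map_sub] at h₁ h₄ h₅ h₆
    linear_combination (norm := abel) h₁ - h₂ - h₃ + h₄ - h₅ + h₆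
  | add a b ha hb =>
    simp only [map_add, LinearMap.add_apply, add_sub_add_comm, ha, hb]
  | smul c a ha => simp only [map_smul, LinearMap.smul_apply, ← smul_sub, ha]

variable (K L) in
/-- The operation on `U(L)` which corresponds to `X ↦ X × v` on `S(L)`. -/
def envTimes : L →ₗ[K] Module.End K (UniversalEnvelopingAlgebra K L) :=
  LinearMap.mk₂ K (fun v p => p * UniversalEnvelopingAlgebra.ι K v - envBullet K L p v)
    (fun u u' p => by simp [mul_add]; abel) (fun c u p => by simp [smul_sub])
    (fun u p q => by simp [add_mul]; abel) (fun c u p => by simp [smul_sub])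

theorem envTimes_apply (v : L) (p : UniversalEnvelopingAlgebra K L) :
    envTimes K L v p = p * UniversalEnvelopingAlgebra.ι K v - envBullet K L p v := rfl

/-- The Leibniz rule of • v for ×, now on U(L); it is equivalent to `envBullet_envBullet` through
the recursion for p • v. -/
theorem envBullet_envTimes (p : UniversalEnvelopingAlgebra K L) (v w : L) :
    envBullet K L (envTimes K L w p) v =
      envTimes K L (w * v) p + envTimes K L w (envBullet K L p v) := by
  have h := envBullet_envBullet p v w
  simp only [envTimes_apply, map_sub, LinearMap.sub_apply, envBullet_mul_ι]
  linear_combination (norm := abel) -h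

/-- After the Leibniz rule, the commutator of v and w in U(L) is compensated by v • w - w • v, and
the iterated • terms by `envBullet_envBullet`. -/
theorem envTimes_comm (v w : L) (p : UniversalEnvelopingAlgebra K L) :
    envTimes K L v (envTimes K L w p) = envTimes K L w (envTimes K L v p) := by
  have h := envBullet_envBullet p v w
  have hι := congrArg (p * ·) (env_ι_lie (K := K) v w)
  rw [envTimes_apply v, envTimes_apply w (envTimes K L v p), envBullet_envTimes,
    envBullet_envTimes]
  simp only [envTimes_apply, sub_mul, mul_sub, mul_assoc] at hι ⊢
  linear_combination (norm := abel) hι - h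

/-- The universal property of S(L) requires a commutative target, which the subalgebra generated by
these commuting operators provides. -/
instance : CommRing (Algebra.adjoin K (Set.range (envTimes K L))) where
  mul_comm := (Algebra.isMulCommutative_adjoin K (by
    rintro _ ⟨v, rfl⟩ _ ⟨w, rfl⟩
    exact LinearMap.ext (envTimes_comm v w))).is_comm.comm

variable (K L) in
/-- The action of `S(L)` on `U(L)` given by the commuting operators `envTimes K L v`. -/
def symActEnv : SymmetricAlgebra K L →ₐ[K] Module.End K (UniversalEnvelopingAlgebra K L) :=
  (Algebra.adjoin K (Set.range (envTimes K L))).val.comp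
    (SymmetricAlgebra.lift ((envTimes K L).codRestrict
      (Subalgebra.toSubmodule (Algebra.adjoin K (Set.range (envTimes K L))))
      fun v => Algebra.subset_adjoin ⟨v, rfl⟩))

theorem symActEnv_ι (v : L) :
    symActEnv K L (SymmetricAlgebra.ι K L v) = envTimes K L v :=
  congrArg Subtype.val (SymmetricAlgebra.lift_ι_apply
    (A := Algebra.adjoin K (Set.range (envTimes K L))) _ v)

variable (K L) in
/-- The inverse of the comparison map `U(L) → S(L)`. -/
def symToEnv : SymmetricAlgebra K L →ₗ[K] UniversalEnvelopingAlgebra K L :=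
  LinearMap.applyₗ 1 ∘ₗ (symActEnv K L).toLinearMap

theorem symToEnv_one : symToEnv K L 1 = 1 := by simp [symToEnv]

theorem symToEnv_mul_ι (X : SymmetricAlgebra K L) (v : L) :
    symToEnv K L (X * SymmetricAlgebra.ι K L v) = envTimes K L v (symToEnv K L X) := by
  simp [symToEnv, mul_comm X, symActEnv_ι]

theorem symToEnv_bulletDer (X : SymmetricAlgebra K L) (v : L) :
    symToEnv K L (bulletDer K L v X) = envBullet K L (symToEnv K L X) v := by
  induction X using sym_induction with
  | one => simp [symToEnv_one, envBullet_one]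
  | mul_ι X w hX =>
    rw [Derivation.leibniz, bulletDer_ι, smul_eq_mul, smul_eq_mul, map_add, symToEnv_mul_ι,
      mul_comm, symToEnv_mul_ι, symToEnv_mul_ι, hX, envBullet_envTimes]
  | add X Y hX hY => simp [hX, hY]
  | smul c X hX => simp [hX]

theorem symToEnv_starRight (X : SymmetricAlgebra K L) (v : L) :
    symToEnv K L (starRight K L v X) =
      symToEnv K L X * UniversalEnvelopingAlgebra.ι K v := by
  rw [starRight_apply, map_add, symToEnv_bulletDer, symToEnv_mul_ι, envTimes_apply]
  abel

/-- The recursion defining • v on U(L) was read off from S(L), so both sides obey it;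
`bulletDer_lie` is what makes it hold in S(L). -/
theorem envToSym_envBullet (p : UniversalEnvelopingAlgebra K L) (v : L) :
    envToSym K L (envBullet K L p v) = bulletDer K L v (envToSym K L p) := by
  induction p using enveloping_induction generalizing v with
  | one => simp [envToSym_one, envBullet_one]
  | mul_ι p u hp =>
    have h := bulletDer_lie u v (envToSym K L p)
    have h' : bulletDer K L ⁅u, v⁆ = bulletDer K L (u * v) - bulletDer K L (v * u) := by
      rw [Ring.lie_def, map_sub]
    rw [h', Derivation.sub_apply] at h
    rw [envBullet_mul_ι, map_sub, map_add, envToSym_mul_ι, envToSym_mul_ι, envToSym_mul_ι, hp, hp]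
    simp only [starRight_apply, map_add, Derivation.leibniz, bulletDer_ι, smul_eq_mul]
    linear_combination h
  | add a b ha hb => simp [ha, hb]
  | smul c a ha => simp [ha]

theorem envToSym_envTimes (p : UniversalEnvelopingAlgebra K L) (v : L) :
    envToSym K L (envTimes K L v p) = envToSym K L p * SymmetricAlgebra.ι K L v := by
  rw [envTimes_apply, map_sub, envToSym_mul_ι, envToSym_envBullet, starRight_apply]
  abel

variable (K L) in
/-- The linear isomorphism `U(L) ≃ S(L)` which sends `u₁ ⋯ uₙ` to `u₁ ⋆ ⋯ ⋆ uₙ`. -/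
def envEquivSym : UniversalEnvelopingAlgebra K L ≃ₗ[K] SymmetricAlgebra K L :=
  LinearEquiv.ofLinearMap (envToSym K L) (symToEnv K L)
    (LinearMap.ext fun X => by
      rw [LinearMap.comp_apply, LinearMap.id_apply]
      induction X using sym_induction with
      | one => rw [symToEnv_one, envToSym_one]
      | mul_ι X v hX => rw [symToEnv_mul_ι, envToSym_envTimes, hX]
      | add X Y hX hY => rw [map_add, map_add, hX, hY]
      | smul c X hX => rw [map_smul, map_smul, hX])
    (LinearMap.ext fun p => by
      rw [LinearMap.comp_apply, LinearMap.id_apply]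
      induction p using enveloping_induction with
      | one => rw [envToSym_one, symToEnv_one]
      | mul_ι p u hp => rw [envToSym_mul_ι, symToEnv_starRight, hp]
      | add a b ha hb => rw [map_add, map_add, ha, hb]
      | smul c a ha => rw [map_smul, map_smul, ha])

theorem envEquivSym_apply (p : UniversalEnvelopingAlgebra K L) :
    envEquivSym K L p = envToSym K L p := rfl

theorem starRight_induction {P : SymmetricAlgebra K L → Prop} (one : P 1)
    (starRight : ∀ X v, P X → P (starRight K L v X))
    (add : ∀ X Y, P X → P Y → P (X + Y)) (smul : ∀ (c : K) X, P X → P (c • X))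
    (X : SymmetricAlgebra K L) : P X := by
  obtain ⟨p, rfl⟩ := (envEquivSym K L).surjective X
  rw [envEquivSym_apply]
  induction p using enveloping_induction with
  | one => rwa [envToSym_one]
  | mul_ι p u hp => rw [envToSym_mul_ι]; exact starRight _ _ hp
  | add a b ha hb => rw [map_add]; exact add _ _ ha hb
  | smul c a ha => rw [map_smul]; exact smul _ _ ha

end PreLie

end Enveloping

/-! ### Convolution products, derivations and coderivations. -/

section Convolution

variable {R C A : Type*} [CommRing R] [AddCommGroup C] [Module R C] [Coalgebra R C]
  [Ring A] [Algebra R A]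

/-- The convolution product of linear maps, as a bilinear map. -/
def conv : (C →ₗ[R] A) →ₗ[R] (C →ₗ[R] A) →ₗ[R] (C →ₗ[R] A) :=
  LinearMap.mk₂ R
    (fun φ ψ => LinearMap.mul' R A ∘ₗ TensorProduct.map φ ψ ∘ₗ Coalgebra.comul)
    (fun φ φ' ψ => by ext; simp [TensorProduct.map_add_left])
    (fun c φ ψ => by ext; simp [TensorProduct.map_smul_left])
    (fun φ ψ ψ' => by ext; simp [TensorProduct.map_add_right])
    (fun c φ ψ => by ext; simp [TensorProduct.map_smul_right])

theorem conv_apply (φ ψ : C →ₗ[R] A) (c : C) :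
    conv φ ψ c = LinearMap.mul' R A (TensorProduct.map φ ψ (Coalgebra.comul c)) := rfl

theorem conv_apply_of_comul_eq_sum {ι : Type*} (φ ψ : C →ₗ[R] A) (c : C) (s : Finset ι)
    (l r : ι → C) (h : Coalgebra.comul (R := R) c = ∑ i ∈ s, l i ⊗ₜ r i) :
    conv φ ψ c = ∑ i ∈ s, φ (l i) * ψ (r i) := by
  simp [conv_apply, h]

theorem counit_conv (a : A) (ψ : C →ₗ[R] A) (c : C) :
    conv (LinearMap.toSpanSingleton R A a ∘ₗ Coalgebra.counit) ψ c = a * ψ c := by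
  have h : conv (LinearMap.toSpanSingleton R A a ∘ₗ Coalgebra.counit) ψ c =
      LinearMap.mul' R A (TensorProduct.map (LinearMap.toSpanSingleton R A a) ψ
        (LinearMap.rTensor C Coalgebra.counit (Coalgebra.comul c))) := by
    rw [conv_apply, ← LinearMap.comp_apply (TensorProduct.map _ _) (LinearMap.rTensor _ _),
      LinearMap.map_comp_rTensor]
  rw [h, Coalgebra.rTensor_counit_comul]
  simp

/-- A coderivation of the coalgebra acts on convolution products by the Leibniz rule. -/
theorem conv_apply_coderivation (P : C →ₗ[R] C) (φ ψ : C →ₗ[R] A) (c : C)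
    (hP : Coalgebra.comul (R := R) (P c) = LinearMap.rTensor C P (Coalgebra.comul c) +
      LinearMap.lTensor C P (Coalgebra.comul c)) :
    conv φ ψ (P c) = conv (φ ∘ₗ P) ψ c + conv φ (ψ ∘ₗ P) c := by
  simp only [conv_apply, hP, map_add]
  rw [← LinearMap.comp_apply (TensorProduct.map _ _) (LinearMap.rTensor _ _),
    LinearMap.map_comp_rTensor,
    ← LinearMap.comp_apply (TensorProduct.map _ _) (LinearMap.lTensor _ _),
    LinearMap.map_comp_lTensor]

/-- A derivation of the algebra acts on convolution products by the Leibniz rule. -/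
theorem derivation_conv (E : A →ₗ[R] A) (hE : ∀ a b, E (a * b) = E a * b + a * E b)
    (φ ψ : C →ₗ[R] A) (c : C) :
    E (conv φ ψ c) = conv (E ∘ₗ φ) ψ c + conv φ (E ∘ₗ ψ) c := by
  simp only [conv_apply]
  induction Coalgebra.comul (R := R) c using TensorProduct.induction_on with
  | zero => simp
  | tmul x y => simp [hE]
  | add x y hx hy => simp only [map_add, hx, hy]; abel

theorem conv_mulRight {A : Type*} [CommRing A] [Algebra R A] (a : A) (φ ψ : C →ₗ[R] A) (c : C) :
    conv φ (LinearMap.mulRight R a ∘ₗ ψ) c = conv φ ψ c * a := by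
  simp only [conv_apply]
  induction Coalgebra.comul (R := R) c using TensorProduct.induction_on with
  | zero => simp
  | tmul x y => simp [mul_assoc]
  | add x y hx hy => simp only [map_add, hx, hy, add_mul]

end Convolution

/-! ### The coalgebra S(L). -/

section SymmetricCoalgebra

variable {K L : Type*} [CommRing K]

section Module

variable [AddCommGroup L] [Module K L]

theorem comul_mul_ι (X : SymmetricAlgebra K L) (v : L) :
    Coalgebra.comul (R := K) (X * SymmetricAlgebra.ι K L v) = Coalgebra.comul (R := K) X *
      (SymmetricAlgebra.ι K L v ⊗ₜ[K] 1 + 1 ⊗ₜ[K] SymmetricAlgebra.ι K L v) := by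
  rw [Bialgebra.comul_mul, SymmetricAlgebra.comul_ι]

theorem counit_mul_ι (X : SymmetricAlgebra K L) (v : L) :
    Coalgebra.counit (R := K) (X * SymmetricAlgebra.ι K L v) = 0 := by
  rw [Bialgebra.counit_mul, SymmetricAlgebra.counit_ι, mul_zero]

/-- The coproduct is multiplicative, and expanding the product of the wᵢ ⊗ 1 + 1 ⊗ wᵢ amounts to
choosing a subset. -/
theorem comul_prod_ι {ι : Type*} [DecidableEq ι] (w : ι → L) (s : Finset ι) :
    Coalgebra.comul (R := K) (∏ i ∈ s, SymmetricAlgebra.ι K L (w i)) =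
      ∑ t ∈ s.powerset, (∏ i ∈ t, SymmetricAlgebra.ι K L (w i)) ⊗ₜ[K]
        (∏ i ∈ s \ t, SymmetricAlgebra.ι K L (w i)) := by
  have h := map_prod (Bialgebra.comulAlgHom K (SymmetricAlgebra K L))
    (fun i => SymmetricAlgebra.ι K L (w i)) s
  simp only [Bialgebra.comulAlgHom_apply, SymmetricAlgebra.comul_ι] at h
  rw [h, Finset.prod_add]
  refine Finset.sum_congr rfl fun t _ => ?_
  have h₁ := map_prod (Algebra.TensorProduct.includeLeft (R := K) (S := K)
    (A := SymmetricAlgebra K L) (B := SymmetricAlgebra K L))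
    (fun i => SymmetricAlgebra.ι K L (w i)) t
  have h₂ := map_prod (Algebra.TensorProduct.includeRight (R := K)
    (A := SymmetricAlgebra K L) (B := SymmetricAlgebra K L))
    (fun i => SymmetricAlgebra.ι K L (w i)) (s \ t)
  simp only [Algebra.TensorProduct.includeLeft_apply, Algebra.TensorProduct.includeRight_apply]
    at h₁ h₂
  rw [← h₁, ← h₂, Algebra.TensorProduct.tmul_mul_tmul, one_mul, mul_one]

theorem counit_prod_ι {ι : Type*} (w : ι → L) {s : Finset ι} (hs : s.Nonempty) :
    Coalgebra.counit (R := K) (∏ i ∈ s, SymmetricAlgebra.ι K L (w i)) = 0 := by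
  obtain ⟨i, hi⟩ := hs
  have h := map_prod (Bialgebra.counitAlgHom K (SymmetricAlgebra K L))
    (fun i => SymmetricAlgebra.ι K L (w i)) s
  rw [Bialgebra.counitAlgHom_apply] at h
  rw [h]
  exact Finset.prod_eq_zero hi (SymmetricAlgebra.counit_ι K L _)

theorem conv_prod_ι {A ι : Type*} [Ring A] [Algebra K A] [DecidableEq ι]
    (φ ψ : SymmetricAlgebra K L →ₗ[K] A) (w : ι → L) (s : Finset ι) :
    conv φ ψ (∏ i ∈ s, SymmetricAlgebra.ι K L (w i)) =
      ∑ t ∈ s.powerset, φ (∏ i ∈ t, SymmetricAlgebra.ι K L (w i)) *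
        ψ (∏ i ∈ s \ t, SymmetricAlgebra.ι K L (w i)) :=
  conv_apply_of_comul_eq_sum _ _ _ _ _ _ (comul_prod_ι w s)

theorem conv_one {A : Type*} [Ring A] [Algebra K A]
    (φ ψ : SymmetricAlgebra K L →ₗ[K] A) : conv φ ψ 1 = φ 1 * ψ 1 := by
  rw [conv_apply, Bialgebra.comul_one, Algebra.TensorProduct.one_def]
  simp

theorem conv_ι {A : Type*} [Ring A] [Algebra K A]
    (φ ψ : SymmetricAlgebra K L →ₗ[K] A) (v : L) :
    conv φ ψ (SymmetricAlgebra.ι K L v) =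
      φ (SymmetricAlgebra.ι K L v) * ψ 1 + φ 1 * ψ (SymmetricAlgebra.ι K L v) := by
  rw [conv_apply, SymmetricAlgebra.comul_ι]
  simp

theorem sym_linearMap_ext {N : Type*} [AddCommGroup N] [Module K N]
    {φ ψ : SymmetricAlgebra K L →ₗ[K] N}
    (h : ∀ (k : ℕ) (w : Fin k → L), φ (∏ i, SymmetricAlgebra.ι K L (w i)) =
      ψ (∏ i, SymmetricAlgebra.ι K L (w i))) : φ = ψ := by
  have key : ∀ X : SymmetricAlgebra K L, X ∈ Submodule.span K
      (Set.range fun w : (Σ k, Fin k → L) => ∏ i, SymmetricAlgebra.ι K L (w.2 i)) := by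
    intro X
    induction X using sym_induction with
    | one => exact Submodule.subset_span ⟨⟨0, Fin.elim0⟩, by simp⟩
    | mul_ι X v hX =>
      induction hX using Submodule.span_induction with
      | mem X hX =>
        obtain ⟨⟨k, w⟩, rfl⟩ := hX
        exact Submodule.subset_span ⟨⟨k + 1, Fin.snoc w v⟩, by simp [Fin.prod_univ_castSucc]⟩
      | zero => simp
      | add X Y _ _ hX hY => rw [add_mul]; exact add_mem hX hY
      | smul c X _ hX => rw [smul_mul_assoc]; exact Submodule.smul_mem _ _ hX
    | add X Y hX hY => exact add_mem hX hY
    | smul c X hX => exact Submodule.smul_mem _ _ hX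
  ext X
  refine LinearMap.eqOn_span ?_ (key X)
  rintro _ ⟨⟨k, w⟩, rfl⟩
  exact h k w

/-- A convolution idempotent which maps `1` to `1` is the unit of the convolution product. -/
theorem eq_counit_of_conv_self {A : Type*} [Ring A] [Algebra K A]
    {g : SymmetricAlgebra K L →ₗ[K] A} (h1 : g 1 = 1) (hg : conv g g = g) :
    g = Algebra.linearMap K A ∘ₗ Coalgebra.counit := by
  refine sym_linearMap_ext fun k w => ?_
  have key : ∀ s : Finset (Fin k), s.Nonempty → g (∏ i ∈ s, SymmetricAlgebra.ι K L (w i)) = 0 := by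
    intro s
    induction s using Finset.strongInduction with
    | H s ih =>
      intro hs
      have h := conv_prod_ι g g w s
      -- By induction only t = ∅ and t = s contribute, so g(s) = g(s) + g(s) and g(s) = 0.
      rw [hg, ← Finset.sum_subset (s₁ := {∅, s}), Finset.sum_pair hs.ne_empty.symm] at h
      · simpa [h1] using h
      · intro t ht
        aesop
      · intro t ht ht'
        simp only [Finset.mem_insert, Finset.mem_singleton, not_or] at ht'
        rw [ih t ((Finset.mem_powerset.1 ht).ssubset_of_ne ht'.2)
          (Finset.nonempty_iff_ne_empty.2 ht'.1), zero_mul]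
  rcases (Finset.univ : Finset (Fin k)).eq_empty_or_nonempty with h | h
  · simp [h, h1]
  · rw [key _ h, LinearMap.comp_apply, counit_prod_ι w h, map_zero]

end Module

section PreLie

variable [RightPreLieRing L] [RightPreLieAlgebra K L]

/-- A derivation of S(L) that preserves the primitive elements of L is also a coderivation. -/
theorem comul_bulletDer (v : L) (X : SymmetricAlgebra K L) :
    Coalgebra.comul (R := K) (bulletDer K L v X) =
      LinearMap.rTensor _ (bulletDer K L v : SymmetricAlgebra K L →ₗ[K] SymmetricAlgebra K L)
        (Coalgebra.comul X) +
      LinearMap.lTensor _ (bulletDer K L v : SymmetricAlgebra K L →ₗ[K] SymmetricAlgebra K L)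
        (Coalgebra.comul X) := by
  induction X using sym_induction with
  | one => simp [Bialgebra.comul_one, Algebra.TensorProduct.one_def]
  | mul_ι X w hX =>
    rw [Derivation.leibniz, bulletDer_ι, smul_eq_mul, smul_eq_mul, map_add, comul_mul_ι,
      mul_comm (SymmetricAlgebra.ι K L w), comul_mul_ι, comul_mul_ι, hX]
    induction Coalgebra.comul (R := K) X using TensorProduct.induction_on with
    | zero => simp
    | tmul x y =>
      simp [mul_add, TensorProduct.tmul_add, TensorProduct.add_tmul, add_mul, mul_comm]
      abel
    | add x y hx hy =>
      simp only [map_add, add_mul] at hx hy ⊢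
      linear_combination hx + hy
  | add X Y hX hY => simp only [map_add, hX, hY]; abel
  | smul c X hX => simp [hX]

/-- Multiplication by a primitive element is a coderivation too, and coderivations add up. Unlike •
v, the operator ⋆ v is not a derivation of ×. -/
theorem comul_starRight (v : L) (X : SymmetricAlgebra K L) :
    Coalgebra.comul (R := K) (starRight K L v X) =
      LinearMap.rTensor _ (starRight K L v) (Coalgebra.comul X) +
      LinearMap.lTensor _ (starRight K L v) (Coalgebra.comul X) := by
  rw [starRight_apply, map_add, comul_bulletDer, comul_mul_ι]
  induction Coalgebra.comul (R := K) X using TensorProduct.induction_on with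
  | zero => simp
  | tmul x y =>
    simp [starRight_apply, mul_add, TensorProduct.tmul_add, TensorProduct.add_tmul]
    abel
  | add x y hx hy =>
    simp only [map_add, add_mul] at hx hy ⊢
    linear_combination hx + hy

theorem counit_bulletDer (v : L) (X : SymmetricAlgebra K L) :
    Coalgebra.counit (R := K) (bulletDer K L v X) = 0 := by
  induction X using sym_induction with
  | one => simp
  | mul_ι X w hX =>
    rw [Derivation.leibniz, bulletDer_ι, smul_eq_mul, smul_eq_mul, map_add, counit_mul_ι,
      Bialgebra.counit_mul, hX]
    simp
  | add X Y hX hY => simp [hX, hY]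
  | smul c X hX => simp [hX]

theorem counit_starRight (v : L) (X : SymmetricAlgebra K L) :
    Coalgebra.counit (R := K) (starRight K L v X) = 0 := by
  rw [starRight_apply, map_add, counit_bulletDer, counit_mul_ι, add_zero]

end PreLie

end SymmetricCoalgebra

/-! ### The shuffle algebra and the action of S(T(V, f)) on T(V). -/

section Shuffle

variable {K V : Type*} [CommRing K] [AddCommGroup V] [Module K V]

variable (K V) in
/-- The vector space `T(V)`, to be equipped with the shuffle product. -/
def ShuffleAlgebra : Type _ := TensorAlgebra K V

instance : AddCommGroup (ShuffleAlgebra K V) :=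
  inferInstanceAs (AddCommGroup (TensorAlgebra K V))

instance : Module K (ShuffleAlgebra K V) :=
  inferInstanceAs (Module K (TensorAlgebra K V))

variable (K V) in
/-- The identity map from `T(V)` to the shuffle algebra. -/
def toShuffle : TensorAlgebra K V ≃ₗ[K] ShuffleAlgebra K V := LinearEquiv.refl K _

/-- The multiplication is the shuffle product. -/
instance : CommRing (ShuffleAlgebra K V) where
  __ := (inferInstance : AddCommGroup (ShuffleAlgebra K V))
  mul a b := toShuffle K V (shuffle ((toShuffle K V).symm a) ((toShuffle K V).symm b))
  one := toShuffle K V 1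
  left_distrib a b c := by change toShuffle K V _ = toShuffle K V _ + toShuffle K V _; simp
  right_distrib a b c := by change toShuffle K V _ = toShuffle K V _ + toShuffle K V _; simp
  zero_mul a := by change toShuffle K V _ = 0; simp
  mul_zero a := by change toShuffle K V _ = 0; simp
  one_mul a := one_shuffle _
  mul_one a := shuffle_one _
  mul_assoc a b c := shuffle_assoc _ _ _
  mul_comm a b := shuffle_comm _ _

theorem toShuffle_shuffle (a b : TensorAlgebra K V) :
    toShuffle K V (shuffle a b) = toShuffle K V a * toShuffle K V b := rfl

theorem toShuffle_symm_mul (a b : ShuffleAlgebra K V) :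
    (toShuffle K V).symm (a * b) =
      shuffle ((toShuffle K V).symm a) ((toShuffle K V).symm b) := rfl

instance : Algebra K (ShuffleAlgebra K V) :=
  Algebra.ofModule
    (fun c a b => by
      apply (toShuffle K V).symm.injective
      simp [toShuffle_symm_mul])
    (fun c a b => by
      apply (toShuffle K V).symm.injective
      simp [toShuffle_symm_mul])

theorem toShuffle_shuffleProd {k : ℕ} (w : Fin k → TensorAlgebra K V) (I : Finset (Fin k)) :
    toShuffle K V (shuffleProd w I) = ∏ i ∈ I, toShuffle K V (w i) := by
  have h : ∀ l : List (Fin k), toShuffle K V ((l.map w).foldr (fun a b => shuffle a b) 1) =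
      (l.map fun i => toShuffle K V (w i)).prod := by
    intro l
    induction l with
    | nil => rfl
    | cons a l ih =>
      simp only [List.map_cons, List.foldr_cons, List.prod_cons, toShuffle_shuffle, ih]
  rw [shuffleProd, h, ← List.prod_toFinset _ ((List.nodup_finRange k).filter _)]
  congr 1
  ext i
  simp

open Polynomial in
/-- The map `a Xⁿ ↦ fⁿ(x) a`, from polynomials over the shuffle algebra to `T(V)`. -/
def letterMap (f : V →ₗ[K] V) : V →ₗ[K] (ShuffleAlgebra K V)[X] →ₗ[K] TensorAlgebra K V where
  toFun x := Polynomial.lsum fun n =>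
    LinearMap.mulLeft K (TensorAlgebra.ι K ((f ^ n) x)) ∘ₗ (toShuffle K V).symm.toLinearMap
  map_add' x y := by
    ext p
    simp [Polynomial.sum_def, add_mul, Finset.sum_add_distrib]
  map_smul' c x := by
    ext p
    simp [Polynomial.sum_def, Finset.smul_sum]

theorem letterMap_monomial (f : V →ₗ[K] V) (x : V) (n : ℕ) (a : ShuffleAlgebra K V) :
    letterMap f x (Polynomial.monomial n a) =
      TensorAlgebra.ι K ((f ^ n) x) * (toShuffle K V).symm a := by
  simp [letterMap, Polynomial.sum_monomial_index]

open Polynomial in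
/-- The right product `a ↦ a • v` on the coefficients of polynomials. -/
def coeffBullet (f : V →ₗ[K] V) (v : TensorAlgebra K V) :
    (ShuffleAlgebra K V)[X] →ₗ[K] (ShuffleAlgebra K V)[X] :=
  Polynomial.lsum fun n => (Polynomial.monomial n).restrictScalars K ∘ₗ
    (toShuffle K V).toLinearMap ∘ₗ (bullet f).flip v ∘ₗ (toShuffle K V).symm.toLinearMap

theorem coeffBullet_monomial (f : V →ₗ[K] V) (v : TensorAlgebra K V) (n : ℕ)
    (a : ShuffleAlgebra K V) :
    coeffBullet f v (Polynomial.monomial n a) =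
      Polynomial.monomial n (toShuffle K V (bullet f ((toShuffle K V).symm a) v)) := by
  simp [coeffBullet, Polynomial.sum_monomial_index]

open Polynomial in
-- This is `shuffle_bullet`, coefficient by coefficient.
theorem coeffBullet_mul (f : V →ₗ[K] V) (v : TensorAlgebra K V) (p q : (ShuffleAlgebra K V)[X]) :
    coeffBullet f v (p * q) = coeffBullet f v p * q + p * coeffBullet f v q := by
  induction p using Polynomial.induction_on' with
  | add p p' hp hp' => simp only [add_mul, map_add, hp, hp']; ring
  | monomial m a =>
    induction q using Polynomial.induction_on' with
    | add q q' hq hq' => simp only [mul_add, map_add, hq, hq']; ring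
    | monomial n b =>
      simp only [Polynomial.monomial_mul_monomial, coeffBullet_monomial, ← map_add,
        toShuffle_symm_mul, shuffle_bullet]
      simp only [map_add, toShuffle_shuffle, LinearEquiv.apply_symm_apply]

open Polynomial in
-- The recursion (fⁿ(x) a) • v = fⁿ(x) (a • v) + fⁿ⁺¹(x) (a ⧢ v) in polynomial form: the degree
-- counts the applications of f, and multiplication by v in degree one produces the second term.
theorem letterMap_coeffBullet (f : V →ₗ[K] V) (x : V) (v : TensorAlgebra K V)
    (p : (ShuffleAlgebra K V)[X]) :
    letterMap f x (coeffBullet f v p + p * Polynomial.monomial 1 (toShuffle K V v)) =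
      bullet f (letterMap f x p) v := by
  induction p using Polynomial.induction_on' with
  | add p q hp hq =>
    simp only [add_mul, map_add, LinearMap.add_apply, ← hp, ← hq]
    abel
  | monomial n a =>
    rw [coeffBullet_monomial, Polynomial.monomial_mul_monomial, map_add, letterMap_monomial,
      letterMap_monomial, letterMap_monomial, cons_bullet, pow_succ', toShuffle_symm_mul]
    simp

open Polynomial in
/-- The algebra morphism which maps `w₁ × ⋯ × w_k` to `(w₁ ⧢ ⋯ ⧢ w_k) Xᵏ`. -/
def shufflePoly (f : V →ₗ[K] V) : STVf f →ₐ[K] (ShuffleAlgebra K V)[X] :=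
  SymmetricAlgebra.lift ((Polynomial.monomial 1).restrictScalars K ∘ₗ
    (toShuffle K V).toLinearMap ∘ₗ (toTVf f).symm.toLinearMap)

theorem shufflePoly_ι (f : V →ₗ[K] V) (v : TVf f) :
    shufflePoly f (SymmetricAlgebra.ι K _ v) =
      Polynomial.monomial 1 (toShuffle K V ((toTVf f).symm v)) := by
  simp [shufflePoly]

theorem shufflePoly_timesProd (f : V →ₗ[K] V) {k : ℕ} (w : Fin k → TensorAlgebra K V)
    (I : Finset (Fin k)) :
    shufflePoly f (timesProd f w I) =
      Polynomial.monomial I.card (toShuffle K V (shuffleProd w I)) := by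
  have h : ∀ i, shufflePoly f (incl f (w i)) = Polynomial.monomial 1 (toShuffle K V (w i)) :=
    fun i => by simp [incl, shufflePoly_ι]
  simp only [timesProd, map_prod, h, toShuffle_shuffleProd]
  induction I using Finset.induction_on with
  | empty => simp
  | insert a I ha ih =>
    rw [Finset.prod_insert ha, ih, Finset.prod_insert ha, Finset.card_insert_of_notMem ha,
      Polynomial.monomial_mul_monomial, add_comm]

theorem shufflePoly_bulletDer (f : V →ₗ[K] V) (v : TVf f) (X : STVf f) :
    shufflePoly f (bulletDer K (TVf f) v X) =
      coeffBullet f ((toTVf f).symm v) (shufflePoly f X) := by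
  have h1 : coeffBullet f ((toTVf f).symm v) 1 = 0 := by
    have h := coeffBullet_mul f ((toTVf f).symm v) 1 1
    simpa using h
  induction X using sym_induction with
  | one => simp [h1]
  | mul_ι X w hX =>
    rw [Derivation.leibniz, bulletDer_ι, smul_eq_mul, smul_eq_mul, map_add,
      map_mul (shufflePoly f), map_mul (shufflePoly f), map_mul (shufflePoly f), hX,
      coeffBullet_mul, shufflePoly_ι, shufflePoly_ι, coeffBullet_monomial, TVf_mul_def]
    simp only [LinearEquiv.symm_apply_apply]
    ring
  | add X Y hX hY => simp only [map_add, hX, hY]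
  | smul c X hX => simp only [map_smul, Derivation.map_smul, hX]

/-- The inclusion of `T(V)` into the polynomials over the shuffle algebra, as constants. -/
def shuffleC : TensorAlgebra K V →ₗ[K] Polynomial (ShuffleAlgebra K V) :=
  (Polynomial.monomial 0).restrictScalars K ∘ₗ (toShuffle K V).toLinearMap

theorem shuffleC_apply (a : TensorAlgebra K V) :
    shuffleC a = Polynomial.monomial 0 (toShuffle K V a) := rfl

/-- The action `u • X` of `X ∈ S(T(V, f))` on `u ∈ T(V, f)`, defined by recursion on `u`:
`∅ • X = ε(X) ∅`, and `xw • X` is the sum of the `fⁿ(x) ((w • X⁽¹⁾) ⧢ a)`, where `a Xⁿ` is the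
image of `X⁽²⁾` by `shufflePoly f`. -/
def extBullet (f : V →ₗ[K] V) : TensorAlgebra K V →ₗ[K] STVf f →ₗ[K] TensorAlgebra K V :=
  wordRec (LinearMap.toSpanSingleton K _ 1 ∘ₗ Coalgebra.counit)
    (LinearMap.mk₂ K
      (fun x p => letterMap f x ∘ₗ conv (shuffleC ∘ₗ p.2) (shufflePoly f).toLinearMap)
      (fun x y p => by ext; simp) (fun c x p => by ext; simp)
      (fun x p q => by ext; simp [LinearMap.comp_add])
      (fun c x p => by ext; simp [LinearMap.comp_smul]))

theorem extBullet_one_left (f : V →ₗ[K] V) (X : STVf f) :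
    extBullet f 1 X = Coalgebra.counit (R := K) X • 1 := by
  rw [extBullet, wordRec_one]; rfl

theorem extBullet_cons (f : V →ₗ[K] V) (x : V) (u : TensorAlgebra K V) (X : STVf f) :
    extBullet f (TensorAlgebra.ι K x * u) X =
      letterMap f x (conv (shuffleC ∘ₗ extBullet f u) (shufflePoly f).toLinearMap X) := by
  conv_lhs => rw [extBullet, wordRec_cons]
  rfl

theorem extBullet_one_right (f : V →ₗ[K] V) (u : TensorAlgebra K V) :
    extBullet f u 1 = u := by
  induction u using word_induction with
  | one => simp [extBullet_one_left]
  | cons x u ih =>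
    rw [extBullet_cons, conv_one, AlgHom.toLinearMap_apply, map_one (shufflePoly f), mul_one,
      LinearMap.comp_apply, ih, shuffleC_apply, letterMap_monomial]
    simp
  | add a b ha hb => simp [ha, hb]
  | smul c a ha => simp [ha]

/-- Induction on the word. As ⋆ v is a coderivation, it acts on both factors of the convolution
defining (x u) • X: on the first as • v, by induction, and on the second as • v plus multiplication
by v in degree one. The two • v terms combine into a derivation of the product, and
`letterMap_coeffBullet` reassembles everything. For the empty word, the counit kills X ⋆ v just as ∅
• v = 0. -/
theorem extBullet_starRight (f : V →ₗ[K] V) (u : TensorAlgebra K V) (v : TVf f) (X : STVf f) :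
    extBullet f u (starRight K (TVf f) v X) =
      bullet f (extBullet f u X) ((toTVf f).symm v) := by
  induction u using word_induction generalizing X with
  | one => simp [extBullet_one_left, counit_starRight, one_bullet]
  | cons x u ih =>
    have h₁ : (shuffleC ∘ₗ extBullet f u) ∘ₗ starRight K (TVf f) v =
        coeffBullet f ((toTVf f).symm v) ∘ₗ shuffleC ∘ₗ extBullet f u := by
      ext Y : 1
      simp only [LinearMap.comp_apply, ih, shuffleC_apply, coeffBullet_monomial,
        LinearEquiv.symm_apply_apply]
    have h₂ : (shufflePoly f).toLinearMap ∘ₗ starRight K (TVf f) v =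
        coeffBullet f ((toTVf f).symm v) ∘ₗ (shufflePoly f).toLinearMap +
          LinearMap.mulRight K (Polynomial.monomial 1 (toShuffle K V ((toTVf f).symm v))) ∘ₗ
            (shufflePoly f).toLinearMap := by
      refine LinearMap.ext fun Y => ?_
      simp only [LinearMap.comp_apply, LinearMap.add_apply, AlgHom.toLinearMap_apply,
        starRight_apply, map_add (shufflePoly f), map_mul (shufflePoly f), shufflePoly_bulletDer,
        shufflePoly_ι, LinearMap.mulRight_apply]
    rw [extBullet_cons, conv_apply_coderivation _ _ _ _ (comul_starRight v X), extBullet_cons,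
      ← letterMap_coeffBullet, derivation_conv _ (coeffBullet_mul f _), h₁, h₂, map_add (conv _),
      LinearMap.add_apply, conv_mulRight, add_assoc]
  | add a b ha hb => simp only [map_add, LinearMap.add_apply, ha, hb]
  | smul c a ha => simp only [map_smul, LinearMap.smul_apply, ha]

end Shuffle

/-! ### The extended product: existence, uniqueness, and ⋆. -/

section OudomGuin

variable {K V : Type*} [CommRing K] [AddCommGroup V] [Module K V] (f : V →ₗ[K] V)

theorem incl_eq_ι (u : TensorAlgebra K V) :
    incl f u = SymmetricAlgebra.ι K (TVf f) (toTVf f u) := rfl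

theorem ι_eq_incl (u : TVf f) :
    SymmetricAlgebra.ι K (TVf f) u = incl f ((toTVf f).symm u) := rfl

theorem incl_injective : Function.Injective (incl f) :=
  symι_injective.comp (toTVf f).injective

/-- The morphism from `S(T(V, f))` to the convolution algebra of its endomorphisms
given by the extended product `•`. -/
def oudomGuinHom : STVf f →ₐ[K] WithConv (STVf f →ₗ[K] STVf f) :=
  SymmetricAlgebra.lift ((WithConv.linearEquiv K (STVf f →ₗ[K] STVf f)).symm.toLinearMap ∘ₗ
    LinearMap.compRight K (incl f) ∘ₗ extBullet f ∘ₗ (toTVf f).symm.toLinearMap)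

/-- The extension of the pre-Lie product of `T(V, f)` to `S(T(V, f))`. -/
def oudomGuin : STVf f →ₗ[K] STVf f →ₗ[K] STVf f :=
  (WithConv.linearEquiv K (STVf f →ₗ[K] STVf f)).toLinearMap ∘ₗ (oudomGuinHom f).toLinearMap

theorem oudomGuin_incl (u : TensorAlgebra K V) (X : STVf f) :
    oudomGuin f (incl f u) X = incl f (extBullet f u X) := by
  simp [oudomGuin, oudomGuinHom, incl_eq_ι f u]

theorem oudomGuin_mul (X Y : STVf f) :
    oudomGuin f (X * Y) = conv (oudomGuin f X) (oudomGuin f Y) :=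
  congrArg WithConv.ofConv (map_mul (oudomGuinHom f) X Y)

theorem oudomGuin_one_left (X : STVf f) :
    oudomGuin f 1 X = algebraMap K _ (Coalgebra.counit (R := K) X) :=
  congrArg (fun F : WithConv (STVf f →ₗ[K] STVf f) => F.ofConv X) (map_one (oudomGuinHom f))

theorem bulletDer_incl (u : TensorAlgebra K V) (v : TVf f) :
    bulletDer K (TVf f) v (incl f u) = incl f (bullet f u ((toTVf f).symm v)) := by
  rw [incl_eq_ι, bulletDer_ι, TVf_mul_def, LinearEquiv.symm_apply_apply, incl_eq_ι]

theorem oudomGuin_one_right (X : STVf f) : oudomGuin f X 1 = X := by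
  induction X using sym_induction with
  | one => simp [oudomGuin_one_left]
  | mul_ι X v hX =>
    rw [oudomGuin_mul, conv_one, hX, ι_eq_incl, oudomGuin_incl, extBullet_one_right]
  | add X Y hX hY => simp [hX, hY]
  | smul c X hX => simp [hX]

/-- The case of X in T(V, f) is `extBullet_starRight`. It passes to products because ⋆ v is a
coderivation and • v a derivation. -/
theorem oudomGuin_starRight (X Y : STVf f) (v : TVf f) :
    oudomGuin f X (starRight K (TVf f) v Y) = bulletDer K (TVf f) v (oudomGuin f X Y) := by
  induction X using sym_induction generalizing Y with
  | one => simp [oudomGuin_one_left, counit_starRight]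
  | mul_ι X w hX =>
    have h₁ : oudomGuin f X ∘ₗ starRight K (TVf f) v =
        (bulletDer K (TVf f) v : STVf f →ₗ[K] STVf f) ∘ₗ oudomGuin f X := LinearMap.ext hX
    have h₂ : oudomGuin f (SymmetricAlgebra.ι K (TVf f) w) ∘ₗ starRight K (TVf f) v =
        (bulletDer K (TVf f) v : STVf f →ₗ[K] STVf f) ∘ₗ
          oudomGuin f (SymmetricAlgebra.ι K (TVf f) w) := by
      refine LinearMap.ext fun Z => ?_
      simp only [LinearMap.comp_apply, ι_eq_incl, oudomGuin_incl, extBullet_starRight,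
        Derivation.coeFn_coe, bulletDer_incl]
    rw [oudomGuin_mul, conv_apply_coderivation _ _ _ _ (comul_starRight v Y), h₁, h₂]
    exact (derivation_conv (bulletDer K (TVf f) v : STVf f →ₗ[K] STVf f)
      (fun a b => by simp [mul_comm, add_comm]) _ _ _).symm
  | add X X' hX hX' => simp [hX, hX']
  | smul c X hX => simp [hX]

theorem oudomGuin_ι_right (X : STVf f) (v : TVf f) :
    oudomGuin f X (SymmetricAlgebra.ι K (TVf f) v) = bulletDer K (TVf f) v X := by
  have h := oudomGuin_starRight f X 1 v
  rwa [oudomGuin_one_right, starRight_apply, Derivation.map_one_eq_zero, zero_add, one_mul] at h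

theorem isOudomGuinExtension_oudomGuin : IsOudomGuinExtension f (oudomGuin f) where
  extends_bullet u v := by
    rw [incl_eq_ι f v, oudomGuin_ι_right, bulletDer_incl, LinearEquiv.symm_apply_apply]
  apply_one := oudomGuin_one_right f
  incl_mul u v X := by
    have h := oudomGuin_starRight f (incl f u) X (toTVf f v)
    rw [starRight_apply, map_add] at h
    rw [incl_eq_ι f v, oudomGuin_ι_right, oudomGuin_ι_right, ← h]
    abel
  mul_apply X Y Z := by rw [oudomGuin_mul, conv_apply]

variable {f} {B : STVf f →ₗ[K] STVf f →ₗ[K] STVf f}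

namespace IsOudomGuinExtension

theorem mul_eq_conv (hB : IsOudomGuinExtension f B) (X Y : STVf f) :
    B (X * Y) = conv (B X) (B Y) :=
  LinearMap.ext (hB.mul_apply X Y)

/-- Since 1 × 1 = 1, the map 1 • - is a convolution idempotent. -/
theorem one_left (hB : IsOudomGuinExtension f B) :
    B 1 = Algebra.linearMap K (STVf f) ∘ₗ Coalgebra.counit :=
  eq_counit_of_conv_self (hB.apply_one 1) (by rw [← hB.mul_eq_conv, mul_one])

/-- As v is primitive and X • 1 = X, the map X ↦ X • v is a derivation, fixed by its values on T(V,
f). -/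
theorem ι_right (hB : IsOudomGuinExtension f B) (X : STVf f) (v : TVf f) :
    B X (SymmetricAlgebra.ι K (TVf f) v) = bulletDer K (TVf f) v X := by
  induction X using sym_induction with
  | one => simp [hB.one_left]
  | mul_ι X w hX =>
    rw [hB.mul_eq_conv, conv_ι, hX, hB.apply_one, hB.apply_one, Derivation.leibniz, ι_eq_incl f v,
      ι_eq_incl f w, hB.extends_bullet, bulletDer_incl, smul_eq_mul, smul_eq_mul]
    ring
  | add X Y hX hY => simp [hX, hY]
  | smul c X hX => simp [hX]

theorem incl_starRight (hB : IsOudomGuinExtension f B) (u : TensorAlgebra K V) (X : STVf f)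
    (v : TVf f) : B (incl f u) (starRight K (TVf f) v X) =
      bulletDer K (TVf f) v (B (incl f u) X) := by
  have h := hB.incl_mul u ((toTVf f).symm v) X
  rw [← ι_eq_incl, hB.ι_right, hB.ι_right] at h
  rw [starRight_apply, map_add, h]
  abel

/-- For u in T(V, f), the values u • 1 and u • (X ⋆ v) = (u • X) • v leave no freedom, since the ⋆ v
generate S from 1. -/
theorem unique (hB : IsOudomGuinExtension f B) : B = oudomGuin f := by
  have h : ∀ u, B (incl f u) = oudomGuin f (incl f u) := by
    intro u
    ext X
    induction X using starRight_induction with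
    | one => rw [hB.apply_one, oudomGuin_one_right]
    | starRight X v hX => rw [hB.incl_starRight, oudomGuin_starRight, hX]
    | add X Y hX hY => simp [hX, hY]
    | smul c X hX => simp [hX]
  ext X : 1
  induction X using sym_induction with
  | one => rw [hB.one_left]; exact LinearMap.ext fun X => (oudomGuin_one_left f X).symm
  | mul_ι X v hX => rw [hB.mul_eq_conv, oudomGuin_mul, hX, ι_eq_incl, h]
  | add X Y hX hY => rw [map_add, map_add, hX, hY]
  | smul c X hX => rw [map_smul, map_smul, hX]

end IsOudomGuinExtension

theorem star_eq_conv (X Y : STVf f) : star B X Y = conv (B X) LinearMap.id Y := rfl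

variable (f)

theorem star_oudomGuin_starRight (X Y : STVf f) (v : TVf f) :
    star (oudomGuin f) X (starRight K (TVf f) v Y) =
      starRight K (TVf f) v (star (oudomGuin f) X Y) := by
  have h₁ : oudomGuin f X ∘ₗ starRight K (TVf f) v =
      (bulletDer K (TVf f) v : STVf f →ₗ[K] STVf f) ∘ₗ oudomGuin f X :=
    LinearMap.ext fun Y => oudomGuin_starRight f X Y v
  have h₂ : LinearMap.id ∘ₗ starRight K (TVf f) v =
      (bulletDer K (TVf f) v : STVf f →ₗ[K] STVf f) ∘ₗ LinearMap.id +
        LinearMap.mulRight K (SymmetricAlgebra.ι K (TVf f) v) ∘ₗ LinearMap.id := rfl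
  have h₃ := derivation_conv (bulletDer K (TVf f) v : STVf f →ₗ[K] STVf f)
    (fun a b => by simp [mul_comm, add_comm]) (oudomGuin f X) LinearMap.id Y
  rw [star_eq_conv, conv_apply_coderivation _ _ _ _ (comul_starRight v Y), h₁, h₂, map_add,
    LinearMap.add_apply, conv_mulRight, ← add_assoc, ← h₃, star_eq_conv, starRight_apply]
  rfl

theorem star_oudomGuin_one_right (X : STVf f) : star (oudomGuin f) X 1 = X := by
  rw [star_eq_conv, conv_one, oudomGuin_one_right, LinearMap.id_apply, mul_one]

theorem star_oudomGuin_one_left (X : STVf f) : star (oudomGuin f) 1 X = X := by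
  have h : oudomGuin f 1 = LinearMap.toSpanSingleton K (STVf f) 1 ∘ₗ Coalgebra.counit :=
    LinearMap.ext fun Y => by simp [oudomGuin_one_left, Algebra.algebraMap_eq_smul_one]
  rw [star_eq_conv, h, counit_conv, one_mul, LinearMap.id_apply]

/-- Induction on q: both sides turn right multiplication of q by u into ⋆ u. -/
theorem envEquivSym_mul (p q : UniversalEnvelopingAlgebra K (TVf f)) :
    envEquivSym K (TVf f) (p * q) =
      star (oudomGuin f) (envEquivSym K (TVf f) p) (envEquivSym K (TVf f) q) := by
  simp only [envEquivSym_apply]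
  induction q using enveloping_induction with
  | one => rw [mul_one, envToSym_one, star_oudomGuin_one_right]
  | mul_ι q u hq =>
    rw [← mul_assoc, envToSym_mul_ι, hq, envToSym_mul_ι, star_oudomGuin_starRight]
  | add a b ha hb => simp only [mul_add, map_add, ha, hb, star_eq_conv]
  | smul c a ha => simp only [mul_smul_comm, map_smul, ha, star_eq_conv]

theorem star_oudomGuin_assoc (X Y Z : STVf f) :
    star (oudomGuin f) (star (oudomGuin f) X Y) Z =
      star (oudomGuin f) X (star (oudomGuin f) Y Z) := by
  obtain ⟨p, rfl⟩ := (envEquivSym K (TVf f)).surjective X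
  obtain ⟨q, rfl⟩ := (envEquivSym K (TVf f)).surjective Y
  obtain ⟨r, rfl⟩ := (envEquivSym K (TVf f)).surjective Z
  simp only [← envEquivSym_mul, mul_assoc]

end OudomGuin

/-! ### The explicit formulas. -/

section Formulas

variable {K V : Type*} [CommRing K] [AddCommGroup V] [Module K V] (f : V →ₗ[K] V)

theorem timesProd_eq {k : ℕ} (w : Fin k → TensorAlgebra K V) (I : Finset (Fin k)) :
    timesProd f w I = ∏ i ∈ I, SymmetricAlgebra.ι K (TVf f) (toTVf f (w i)) := rfl

theorem conv_timesProd {A : Type*} [Ring A] [Algebra K A] (φ ψ : STVf f →ₗ[K] A) {k : ℕ}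
    (w : Fin k → TensorAlgebra K V) (I : Finset (Fin k)) :
    conv φ ψ (timesProd f w I) =
      ∑ J ∈ I.powerset, φ (timesProd f w J) * ψ (timesProd f w (I \ J)) :=
  conv_prod_ι φ ψ _ I

theorem extBullet_one_timesProd {k : ℕ} (w : Fin k → TensorAlgebra K V) {I : Finset (Fin k)}
    (hI : I.Nonempty) : extBullet f 1 (timesProd f w I) = 0 := by
  rw [extBullet_one_left, timesProd_eq, counit_prod_ι _ hI, zero_smul]

theorem extBullet_cons_timesProd {k : ℕ} (w : Fin k → TensorAlgebra K V) (I : Finset (Fin k))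
    (x : V) (u : TensorAlgebra K V) :
    extBullet f (TensorAlgebra.ι K x * u) (timesProd f w I) =
      ∑ J ∈ I.powerset, TensorAlgebra.ι K ((f ^ (I \ J).card) x) *
        shuffle (extBullet f u (timesProd f w J)) (shuffleProd w (I \ J)) := by
  rw [extBullet_cons, conv_timesProd, map_sum]
  refine Finset.sum_congr rfl fun J _ => ?_
  rw [AlgHom.toLinearMap_apply, shufflePoly_timesProd, LinearMap.comp_apply, shuffleC_apply,
    Polynomial.monomial_mul_monomial, letterMap_monomial, zero_add, toShuffle_symm_mul]
  simp

/-- The empty word is acted on through the counit, so only the term 1 ⊗ X of the coproduct survives.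
-/
theorem star_oudomGuin_incl_one (X : STVf f) :
    star (oudomGuin f) (incl f 1) X = incl f 1 * X := by
  have h : oudomGuin f (incl f 1) =
      LinearMap.toSpanSingleton K (STVf f) (incl f 1) ∘ₗ Coalgebra.counit :=
    LinearMap.ext fun Y => by simp [oudomGuin_incl, extBullet_one_left]
  rw [star_eq_conv, h, counit_conv, LinearMap.id_apply]

theorem star_oudomGuin_incl_timesProd {k : ℕ} (w : Fin k → TensorAlgebra K V)
    (u : TensorAlgebra K V) :
    star (oudomGuin f) (incl f u) (timesProd f w Finset.univ) =
      ∑ I : Finset (Fin k), incl f (extBullet f u (timesProd f w I)) * timesProd f w Iᶜ := by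
  rw [star_eq_conv, conv_timesProd, Finset.powerset_univ]
  simp only [oudomGuin_incl, LinearMap.id_apply, Finset.compl_eq_univ_sdiff]

/-- The families of `n` pairwise disjoint, possibly empty, sets with union `s`. -/
def partitionsOf (n : ℕ) {k : ℕ} (s : Finset (Fin k)) : Finset (Fin n → Finset (Fin k)) :=
  Finset.univ.filter fun P =>
    (∀ a b, a ≠ b → Disjoint (P a) (P b)) ∧ Finset.univ.biUnion P = s

theorem mem_partitionsOf {n k : ℕ} {s : Finset (Fin k)} {P : Fin n → Finset (Fin k)} :
    P ∈ partitionsOf n s ↔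
      (∀ a b, a ≠ b → Disjoint (P a) (P b)) ∧ Finset.univ.biUnion P = s := by
  simp [partitionsOf]

theorem orderedPartitions_eq (n k : ℕ) :
    orderedPartitions n k = partitionsOf n (Finset.univ : Finset (Fin k)) := rfl

theorem sum_partitionsOf_zero {M : Type*} [AddCommMonoid M] {k : ℕ} (s : Finset (Fin k))
    (F : (Fin 0 → Finset (Fin k)) → M) :
    ∑ P ∈ partitionsOf 0 s, F P = if s = ∅ then F Fin.elim0 else 0 := by
  split_ifs with h
  · subst h
    rw [Finset.sum_eq_single Fin.elim0]
    · intro P _ hP; exact absurd (Subsingleton.elim _ _) hP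
    · intro hP; exact absurd (mem_partitionsOf.2 ⟨fun a => a.elim0, by simp⟩) hP
  · refine Finset.sum_eq_zero fun P hP => absurd ?_ h
    rw [← (mem_partitionsOf.1 hP).2]
    simp

/-- Splitting the member of index `p` off the families of disjoint sets with union `s`. -/
theorem sum_partitionsOf_succ {M : Type*} [AddCommMonoid M] {n k : ℕ} (p : Fin (n + 1))
    (s : Finset (Fin k)) (F : (Fin (n + 1) → Finset (Fin k)) → M) :
    ∑ P ∈ partitionsOf (n + 1) s, F P =
      ∑ I ∈ s.powerset, ∑ Q ∈ partitionsOf n I, F (p.insertNth (s \ I) Q) := by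
  rw [Finset.sum_sigma']
  refine Finset.sum_bij' (fun P _ => ⟨s \ P p, fun j => P (p.succAbove j)⟩)
    (fun q _ => p.insertNth (s \ q.1) q.2) ?_ ?_ ?_ ?_ ?_
  · intro P hP
    obtain ⟨hd, hu⟩ := mem_partitionsOf.1 hP
    rw [Finset.mem_sigma, Finset.mem_powerset, mem_partitionsOf]
    refine ⟨Finset.sdiff_subset, fun a b hab => hd _ _ (by simpa using hab), ?_⟩
    ext i
    rw [← hu]
    simp only [Finset.mem_biUnion, Finset.mem_univ, true_and, Finset.mem_sdiff]
    constructor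
    · rintro ⟨j, hj⟩
      exact ⟨⟨_, hj⟩, fun h => Finset.disjoint_left.1 (hd _ _ (p.succAbove_ne j)) hj h⟩
    · rintro ⟨⟨j, hj⟩, hp⟩
      obtain ⟨j', rfl⟩ := Fin.exists_succAbove_eq (y := p) (x := j) (by rintro rfl; exact hp hj)
      exact ⟨j', hj⟩
  · rintro ⟨I, Q⟩ hq
    rw [Finset.mem_sigma, Finset.mem_powerset, mem_partitionsOf] at hq
    obtain ⟨hI, hd, hu⟩ := hq
    dsimp only at hI hd hu ⊢
    have hsub : ∀ j, Q j ⊆ I := fun j => hu ▸ Finset.subset_biUnion_of_mem Q (Finset.mem_univ j)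
    rw [mem_partitionsOf]
    constructor
    · intro a b hab
      rcases Fin.eq_self_or_eq_succAbove p a with ha | ⟨a, rfl⟩ <;>
      rcases Fin.eq_self_or_eq_succAbove p b with hb | ⟨b, rfl⟩
      · exact absurd (ha.trans hb.symm) hab
      · simpa [ha] using Finset.disjoint_of_subset_right (hsub b) Finset.sdiff_disjoint
      · simpa [hb] using Finset.disjoint_of_subset_left (hsub a) Finset.disjoint_sdiff
      · simpa using hd a b (by rintro rfl; exact hab rfl)
    · ext i
      simp only [Finset.mem_biUnion, Finset.mem_univ, true_and, Fin.exists_iff_succAbove p,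
        Fin.insertNth_apply_same, Fin.insertNth_apply_succAbove]
      have : (∃ j, i ∈ Q j) ↔ i ∈ I := by rw [← hu]; simp
      rw [this, Finset.mem_sdiff]
      have := @hI i
      tauto
  · intro P hP
    obtain ⟨hd, hu⟩ := mem_partitionsOf.1 hP
    have hp : P p ⊆ s := hu ▸ Finset.subset_biUnion_of_mem P (Finset.mem_univ p)
    simp only [Finset.sdiff_sdiff_eq_self hp]
    exact Fin.insertNth_self_removeNth p P
  · rintro ⟨I, Q⟩ hq
    rw [Finset.mem_sigma, Finset.mem_powerset] at hq
    simp [Finset.sdiff_sdiff_eq_self hq.1]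
  · intro P hP
    obtain ⟨hd, hu⟩ := mem_partitionsOf.1 hP
    have hp : P p ⊆ s := hu ▸ Finset.subset_biUnion_of_mem P (Finset.mem_univ p)
    simp only [Finset.sdiff_sdiff_eq_self hp]
    exact congrArg F (Fin.insertNth_self_removeNth p P).symm

theorem extBullet_tprod_timesProd {k : ℕ} (w : Fin k → TensorAlgebra K V) (i : ℕ) (x : Fin i → V)
    (I : Finset (Fin k)) :
    extBullet f (TensorAlgebra.tprod K V i x) (timesProd f w I) =
      ∑ P ∈ partitionsOf i I, nested f w i x P := by
  induction i generalizing I with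
  | zero =>
    rw [sum_partitionsOf_zero, TensorAlgebra.tprod_apply]
    split_ifs with h
    · subst h
      simp [timesProd, extBullet_one_right, nested]
    · simpa using extBullet_one_timesProd f w (Finset.nonempty_iff_ne_empty.2 h)
  | succ i ih =>
    have h : TensorAlgebra.tprod K V (i + 1) x =
        TensorAlgebra.ι K (x 0) * TensorAlgebra.tprod K V i (fun j => x j.succ) := by
      simp [TensorAlgebra.tprod_apply, List.ofFn_succ]
    -- The block of the first letter is I \ J, and J is left for the remaining letters.
    rw [h, extBullet_cons_timesProd, sum_partitionsOf_succ 0]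
    refine Finset.sum_congr rfl fun J _ => ?_
    rw [ih, map_sum, LinearMap.sum_apply, Finset.mul_sum]
    refine Finset.sum_congr rfl fun Q _ => ?_
    simp [nested]

theorem star_oudomGuin_cons_timesProd {k : ℕ} (w : Fin k → TensorAlgebra K V) (x : V)
    (u : TensorAlgebra K V) :
    star (oudomGuin f) (incl f (TensorAlgebra.ι K x * u)) (timesProd f w Finset.univ) =
      ∑ P ∈ orderedPartitions 3 k, incl f (TensorAlgebra.ι K ((f ^ (P 1).card) x) *
        shuffle (extBullet f u (timesProd f w (P 0))) (shuffleProd w (P 1))) *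
        timesProd f w (P 2) := by
  rw [star_oudomGuin_incl_timesProd, orderedPartitions_eq, sum_partitionsOf_succ (Fin.last 2),
    Finset.powerset_univ]
  refine Finset.sum_congr rfl fun I _ => ?_
  rw [extBullet_cons_timesProd, map_sum, Finset.sum_mul, sum_partitionsOf_succ (Fin.last 1)]
  refine Finset.sum_congr rfl fun J _ => ?_
  -- The blocks with indices 2 and 1 are now Iᶜ and I \ J. Nothing may remain once the block with
  -- index 0 is removed as well, which forces it to be J.
  rw [sum_partitionsOf_succ (Fin.last 0), Finset.sum_eq_single ∅]
  · rw [sum_partitionsOf_zero, if_pos rfl, Finset.sdiff_empty, Finset.compl_eq_univ_sdiff]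
    rfl
  · intro J' _ hJ'
    rw [sum_partitionsOf_zero, if_neg hJ']
  · simp

theorem star_oudomGuin_tprod_timesProd {k : ℕ} (w : Fin k → TensorAlgebra K V) (i : ℕ)
    (x : Fin i → V) :
    star (oudomGuin f) (incl f (TensorAlgebra.tprod K V i x)) (timesProd f w Finset.univ) =
      ∑ P ∈ orderedPartitions (i + 1) k,
        incl f (nested f w i x fun j => P j.castSucc) * timesProd f w (P (Fin.last i)) := by
  rw [star_oudomGuin_incl_timesProd, orderedPartitions_eq, sum_partitionsOf_succ (Fin.last i),
    Finset.powerset_univ]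
  refine Finset.sum_congr rfl fun I _ => ?_
  rw [extBullet_tprod_timesProd, map_sum, Finset.sum_mul]
  refine Finset.sum_congr rfl fun Q _ => ?_
  simp [Finset.compl_eq_univ_sdiff]

end Formulas

end ComPreLie

end

theorem mainTheorem7 {K : Type*} [Field K] [CharZero K] {V : Type*} [AddCommGroup V] [Module K V]
    (f : V →ₗ[K] V) :
    ∃ (B : ComPreLie.STVf f →ₗ[K] ComPreLie.STVf f →ₗ[K] ComPreLie.STVf f)
      (b : TensorAlgebra K V →ₗ[K] ComPreLie.STVf f →ₗ[K] TensorAlgebra K V),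
      -- `B` is the unique Oudom-Guin extension of the pre-Lie product
      ComPreLie.IsOudomGuinExtension f B ∧
      (∀ B', ComPreLie.IsOudomGuinExtension f B' → B' = B) ∧
      -- for `u ∈ T(V, f)`, the elements `u • X` lie in `T(V, f)`; as such they are `b u X`
      Function.Injective (ComPreLie.incl f) ∧
      (∀ u X, B (ComPreLie.incl f u) X = ComPreLie.incl f (b u X)) ∧
      -- `⋆` is associative and unital, and is the product of the enveloping algebra of `T(V, f)`
      (∀ X Y Z, ComPreLie.star B (ComPreLie.star B X Y) Z =
        ComPreLie.star B X (ComPreLie.star B Y Z)) ∧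
      (∀ X, ComPreLie.star B 1 X = X ∧ ComPreLie.star B X 1 = X) ∧
      (∃ e : UniversalEnvelopingAlgebra K (ComPreLie.TVf f) ≃ₗ[K] ComPreLie.STVf f,
        e 1 = 1 ∧
        (∀ p q, e (p * q) = ComPreLie.star B (e p) (e q)) ∧
        ∀ u : ComPreLie.TVf f, e (UniversalEnvelopingAlgebra.ι K u) =
          SymmetricAlgebra.ι K (ComPreLie.TVf f) u) ∧
      -- formulas letter by letter
      (∀ (k : ℕ) (w' : Fin k → TensorAlgebra K V), 1 ≤ k →
        b 1 (ComPreLie.timesProd f w' Finset.univ) = 0) ∧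
      (∀ (k : ℕ) (w' : Fin k → TensorAlgebra K V) (x : V) (w : TensorAlgebra K V),
        b (TensorAlgebra.ι K x * w) (ComPreLie.timesProd f w' Finset.univ) =
          ∑ I : Finset (Fin k), TensorAlgebra.ι K ((f ^ (k - I.card)) x) *
            ComPreLie.shuffle (b w (ComPreLie.timesProd f w' I))
              (ComPreLie.shuffleProd w' Iᶜ)) ∧
      (∀ (k : ℕ) (w' : Fin k → TensorAlgebra K V),
        ComPreLie.star B (ComPreLie.incl f 1) (ComPreLie.timesProd f w' Finset.univ) =
          ComPreLie.incl f 1 * ComPreLie.timesProd f w' Finset.univ) ∧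
      (∀ (k : ℕ) (w' : Fin k → TensorAlgebra K V) (x : V) (w : TensorAlgebra K V),
        ComPreLie.star B (ComPreLie.incl f (TensorAlgebra.ι K x * w))
            (ComPreLie.timesProd f w' Finset.univ) =
          ∑ P ∈ ComPreLie.orderedPartitions 3 k,
            ComPreLie.incl f (TensorAlgebra.ι K ((f ^ (P 1).card) x) *
              ComPreLie.shuffle (b w (ComPreLie.timesProd f w' (P 0)))
                (ComPreLie.shuffleProd w' (P 1))) *
              ComPreLie.timesProd f w' (P 2)) ∧
      -- closed formulas for words `x₁ … x_i`
      (∀ (k i : ℕ) (w' : Fin k → TensorAlgebra K V) (x : Fin i → V), 1 ≤ i →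
        b (TensorAlgebra.tprod K V i x) (ComPreLie.timesProd f w' Finset.univ) =
          ∑ P ∈ ComPreLie.orderedPartitions i k, ComPreLie.nested f w' i x P) ∧
      (∀ (k i : ℕ) (w' : Fin k → TensorAlgebra K V) (x : Fin i → V), 1 ≤ i →
        ComPreLie.star B (ComPreLie.incl f (TensorAlgebra.tprod K V i x))
            (ComPreLie.timesProd f w' Finset.univ) =
          ∑ P ∈ ComPreLie.orderedPartitions (i + 1) k,
            ComPreLie.incl f (ComPreLie.nested f w' i x fun j => P j.castSucc) *
              ComPreLie.timesProd f w' (P (Fin.last i))) := by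
  refine ⟨ComPreLie.oudomGuin f, ComPreLie.extBullet f,
    ComPreLie.isOudomGuinExtension_oudomGuin f, fun B' hB' => hB'.unique,
    ComPreLie.incl_injective f, ComPreLie.oudomGuin_incl f, ComPreLie.star_oudomGuin_assoc f,
    fun X => ⟨ComPreLie.star_oudomGuin_one_left f X, ComPreLie.star_oudomGuin_one_right f X⟩,
    ⟨ComPreLie.envEquivSym K (ComPreLie.TVf f), ComPreLie.envToSym_one,
      ComPreLie.envEquivSym_mul f, ComPreLie.envToSym_ι⟩, ?_, ?_,
    fun k w' => ComPreLie.star_oudomGuin_incl_one f _,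
    fun k w' x w => ComPreLie.star_oudomGuin_cons_timesProd f w' x w,
    fun k i w' x _ => ComPreLie.extBullet_tprod_timesProd f w' i x Finset.univ,
    fun k i w' x _ => ComPreLie.star_oudomGuin_tprod_timesProd f w' i x⟩
  · intro k w' hk
    have : Nonempty (Fin k) := ⟨⟨0, hk⟩⟩
    exact ComPreLie.extBullet_one_timesProd f w' Finset.univ_nonempty
  · intro k w' x w
    rw [ComPreLie.extBullet_cons_timesProd, Finset.powerset_univ]
    refine Finset.sum_congr rfl fun I _ => ?_
    rw [← Finset.compl_eq_univ_sdiff, Finset.card_compl, Fintype.card_fin]
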